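/- Let $n\ge 0$, let $W=S_n$ act on $\{1,\dots,n\}$, with length function $\ell$ (number of inversions), Bruhat order $\le$, long element $w_0$ ($w_0(i)=n+1-i$) and simple reflections $s_i=(i,i+1)$. Let $\Phi^+=\{e_i-e_j: i<j\}$, $\Phi^-=-\Phi^+$, $\alpha_i=e_i-e_{i+1}$, let $W$ act on roots by $u(e_i-e_j)=e_{u(i)}-e_{u(j)}$, and put $\boldsymbol y^{e_i-e_j}=y_i/y_j$, where $t,y_1,\dots,y_n,x_1,\dots,x_n$ are indeterminates over $\mathbb C$. Consider the colored lattice model on the $n\times n$ grid, with rows numbered from top to bottom and columns from right to left, and totally ordered colors $1<\dots<n$. Each horizontal edge is decorated by a color or by $+$ (uncolored), and each vertical edge by a set of colors. For a set $\Sigma$ of colors, and for sets $A$ of colors, write $a^{\Sigma_A}=a^{|\Sigma\cap A|}$, and $\Sigma_c=\Sigma_{\{c\}}$. The admissible vertices in row $i$ and column $j$ are the following, listed as (left, top, right, bottom), with their Boltzmann weights, where $z=x_i/y_j$: 1. $(+,\Sigma,+,\Sigma)$, weight $(-t)^{|\Sigma|}$; 2. $(c,\Sigma,c,\Sigma)$,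 weight $t^{\Sigma_{(c,n]}}(-z+t^{\Sigma_c})$; 3. $(+,\Sigma,c,\Sigma\setminus\{c\})$ with $c\in\Sigma$, weight $(-t)^{\Sigma_{[1,c)}}t^{\Sigma_{(c,n]}}$; 4. $(c,\Sigma,+,\Sigma\cup\{c\})$ with $c\notin\Sigma$, weight $(t-1)z(-t)^{\Sigma_{(c,n]}}$; 5. $(c,\Sigma,d,(\Sigma\cup\{c\})\setminus\{d\})$ with $c<d$, $c\notin\Sigma$, $d\in\Sigma$, weight $(t-1)z(-t)^{\Sigma_{(c,d)}}t^{\Sigma_{(d,n]}}$; 6. $(d,\Sigma,c,(\Sigma\cup\{d\})\setminus\{c\})$ with $c<d$, $d\notin\Sigma$, $c\in\Sigma$, weight $(t-1)(-1)^{\Sigma_{(c,d)}}t^{\Sigma_{(d,n]}}$. For $\sigma,w\in W$ let $Z^\square_{\sigma,w}(\boldsymbol x;\boldsymbol y)$ be the partition function (the sum over all admissible states of the product of the weights of the vertices) for the boundary condition in which the top edge of column $j$ carries exactly the color $\sigma(j)$, the right edge of row $i$ carries the color $w(i)$, and all left and bottom edges are uncolored. For $u\in W$ let $Z^\square_{\sigma,w}|_u\in\mathbb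 C(t,y_1,\dots,y_n)$ be the result of setting $x_i=y_{u(i)}$ for all $i$. Then: (a) (Base case) For all $\sigma,u\in W$, $Z^\square_{\sigma,\sigma w_0}|_u\ne0$ if and only if $u=w_0$, and $$Z^\square_{\sigma,\sigma w_0}|_{w_0}=t^{\ell(\sigma)}\prod_{\alpha\in\Phi^+}(1-\boldsymbol y^{-\alpha}).$$ (b) (Recursion) For all $\sigma,w,u\in W$ and all $1\le i\le n-1$, $$Z^\square_{\sigma,ws_i}|_u=\begin{cases}\dfrac{t-1}{1-\boldsymbol y^{u\alpha_i}}Z^\square_{\sigma,w}|_u+\dfrac{\boldsymbol y^{u\alpha_i}-t}{1-\boldsymbol y^{u\alpha_i}}Z^\square_{\sigma,w}|_{us_i}&\text{if }\ell(ws_i)<\ell(w),\\[2ex]\dfrac{(t-1)\boldsymbol y^{u\alpha_i}}{t(1-\boldsymbol y^{u\alpha_i})}Z^\square_{\sigma,w}|_u+\dfrac{\boldsymbol y^{u\alpha_i}-t}{t(1-\boldsymbol y^{u\alpha_i})}Z^\square_{\sigma,w}|_{us_i}&\text{if }\ell(ws_i)>\ell(w).\end{cases}$$ (c) (Vanishing)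 For all $\sigma,w,u\in W$, $Z^\square_{\sigma,w}|_u=0$ unless $\sigma^{-1}w\le u$. (d) (Diagonal) For all $\sigma,w\in W$, the number $\frac12(\ell(\sigma)-\ell(w)+\ell(w^{-1}\sigma))$ is a non-negative integer, and $$Z^\square_{\sigma,w}|_{\sigma^{-1}w}=t^{\frac12(\ell(\sigma)-\ell(w)+\ell(w^{-1}\sigma))}(-1)^{\ell(w^{-1}\sigma w_0)}\prod_{\substack{\alpha\in\Phi^+\\ w^{-1}\sigma(\alpha)\in\Phi^+}}(1-t\boldsymbol y^{-\alpha})\prod_{\substack{\alpha\in\Phi^+\\ w^{-1}\sigma(\alpha)\in\Phi^-}}(1-\boldsymbol y^{-\alpha}).$$ -/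

import Mathlib

namespace ColoredLattice

open Finset

section Weights

/-- The decorations around one vertex are admissible. Here `a` and `b` are the decorations of the
left and right edges (`none` is the uncolored spin `⊕`), and `S` and `T` are the sets of colors on
the top and bottom edges. The branches are Cases 1, 3, 4, and then 2 (if `c = d`) and
5, 6 (if `c ≠ d`) of the table of weights. -/
def VertexAdmissible {r : ℕ} (a : Option (Fin r)) (S : Finset (Fin r)) (b : Option (Fin r))
    (T : Finset (Fin r)) : Prop :=
  match a, b with
  | none, none => T = S
  | none, some c => c ∈ S ∧ T = S.erase c
  | some c, none => c ∉ S ∧ T = insert c S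
  | some c, some d => (c = d ∧ T = S) ∨ (c ≠ d ∧ c ∉ S ∧ d ∈ S ∧ T = (insert c S).erase d)

instance {r : ℕ} (a : Option (Fin r)) (S : Finset (Fin r)) (b : Option (Fin r))
    (T : Finset (Fin r)) : Decidable (VertexAdmissible a S b T) := by
  unfold VertexAdmissible
  split <;> infer_instance

/-- The number of colors of `S` that are larger than `c`. -/
def numAbove {r : ℕ} (S : Finset (Fin r)) (c : Fin r) : ℕ := #{e ∈ S | c < e}

/-- The number of colors of `S` that are smaller than `c`. -/
def numBelow {r : ℕ} (S : Finset (Fin r)) (c : Fin r) : ℕ := #{e ∈ S | e < c}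

/-- The number of colors of `S` strictly between `c` and `d`. -/
def numBetween {r : ℕ} (S : Finset (Fin r)) (c d : Fin r) : ℕ := #{e ∈ S | c < e ∧ e < d}

/-- The Boltzmann weight of an admissible vertex, with `z = x / y` the quotient of the row and the
column parameter, left decoration `a`, top decoration `S` and right decoration `b`.
(The bottom decoration of an admissible vertex is determined by these.) -/
def vertexWeight {R : Type*} [CommRing R] {r : ℕ} (t z : R) (a : Option (Fin r))
    (S : Finset (Fin r)) (b : Option (Fin r)) : R :=
  match a, b with
  | none, none => (-t) ^ #S
  | none, some c => (-t) ^ numBelow S c * t ^ numAbove S c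
  | some c, none => (t - 1) * z * (-t) ^ numAbove S c
  | some c, some d =>
      if c = d then t ^ numAbove S c * (-z + t ^ (if c ∈ S then 1 else 0))
      else if c < d then (t - 1) * z * (-t) ^ numBetween S c d * t ^ numAbove S d
      else (t - 1) * (-1) ^ numBetween S d c * t ^ numAbove S c

end Weights

section States

/-- A decorated lattice with `n` rows, `N` columns and `r` colors. Rows are numbered from top to
bottom and columns from right to left, both starting with `0`. The first component decorates the
vertical edges: in column `j`, the entry `k` is the edge just above row `k`, and the entry `n` is
the bottom boundary edge. The second component decorates the horizontal edges: in row `i`, the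
entry `k` is the edge just to the right of column `k`, and the entry `N` is the left boundary
edge. -/
abbrev DecoratedLattice (n N r : ℕ) : Type :=
  (Fin (n + 1) → Fin N → Finset (Fin r)) × (Fin n → Fin (N + 1) → Option (Fin r))

/-- The decorated lattice `s` is an admissible state for the boundary condition with top boundary
`top`, right boundary `right`, and uncolored bottom and left boundaries. -/
def IsAdmissibleState {n N r : ℕ} (top : Fin N → Finset (Fin r)) (right : Fin n → Option (Fin r))
    (s : DecoratedLattice n N r) : Prop :=
  (∀ j, s.1 0 j = top j) ∧ (∀ j, s.1 (Fin.last n) j = ∅) ∧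
  (∀ i, s.2 i 0 = right i) ∧ (∀ i, s.2 i (Fin.last N) = none) ∧
  ∀ i j, VertexAdmissible (s.2 i j.succ) (s.1 i.castSucc j) (s.2 i j.castSucc) (s.1 i.succ j)

instance {n N r : ℕ} (top : Fin N → Finset (Fin r)) (right : Fin n → Option (Fin r)) :
    DecidablePred (IsAdmissibleState top right) := fun s => by
  unfold IsAdmissibleState
  infer_instance

/-- The Boltzmann weight of a state, where `z i j` is the value of `x / y` at the vertex in row `i`
and column `j`. -/
def stateWeight {R : Type*} [CommRing R] {n N r : ℕ} (t : R) (z : Fin n → Fin N → R)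
    (s : DecoratedLattice n N r) : R :=
  ∏ i, ∏ j, vertexWeight t (z i j) (s.2 i j.succ) (s.1 i.castSucc j) (s.2 i j.castSucc)

/-- The partition function: the sum of the Boltzmann weights of all admissible states. -/
def partitionFunction {R : Type*} [CommRing R] {n N r : ℕ} (t : R) (z : Fin n → Fin N → R)
    (top : Fin N → Finset (Fin r)) (right : Fin n → Option (Fin r)) : R :=
  ∑ s : DecoratedLattice n N r with IsAdmissibleState top right s, stateWeight t z s

/-- The top boundary for `σ` and the partition `lam` (given by `0`-based column indices): the edge
in the column `lam i` carries the color `σ (n + 1 - i)` (in `1`-based numbering). -/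
def topBoundary {n N : ℕ} (σ : Equiv.Perm (Fin n)) (lam : Fin n → Fin N) (j : Fin N) :
    Finset (Fin n) :=
  ({i | lam i = j} : Finset (Fin n)).image fun i => σ i.rev

/-- The right boundary for `w`: the edge in row `i` carries the color `w i`. -/
def rightBoundary {n : ℕ} (w : Equiv.Perm (Fin n)) (i : Fin n) : Option (Fin n) := some (w i)

/-- The partition `(n, n - 1, …, 1)`, as `0`-based column indices. -/
def squarePartition (n : ℕ) : Fin n → Fin n := Fin.rev

end States

section Functions

/-- The field `ℂ(t, y_1, …, y_n)` of rational functions. -/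
abbrev RatField (n : ℕ) : Type := FractionRing (MvPolynomial (Option (Fin n)) ℂ)

/-- The indeterminate `t`. -/
noncomputable def tVar (n : ℕ) : RatField n :=
  algebraMap (MvPolynomial (Option (Fin n)) ℂ) (RatField n) (MvPolynomial.X none)

/-- The indeterminates `y_1, …, y_n`. -/
noncomputable def yVar {n : ℕ} (j : Fin n) : RatField n :=
  algebraMap (MvPolynomial (Option (Fin n)) ℂ) (RatField n) (MvPolynomial.X (some j))

/-- The partition function `Z^□_{σ,w}(x; y)`, as a polynomial in `x_1, …, x_n` with coefficients in
`ℂ(t, y_1, …, y_n)`. -/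
noncomputable def ZSquare {n : ℕ} (σ w : Equiv.Perm (Fin n)) :
    MvPolynomial (Fin n) (RatField n) :=
  partitionFunction (MvPolynomial.C (tVar n))
    (fun i j => MvPolynomial.X i * MvPolynomial.C (yVar j)⁻¹)
    (topBoundary σ (squarePartition n)) (rightBoundary w)

/-- The restriction `f|_u`, obtained by setting `x_i = y_{u(i)}`. -/
noncomputable def restrict {n : ℕ} (f : MvPolynomial (Fin n) (RatField n))
    (u : Equiv.Perm (Fin n)) : RatField n :=
  MvPolynomial.eval (fun i => yVar (u i)) f

end Functions

section Weyl

/-- The length of a permutation: its number of inversions. -/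
def length {n : ℕ} (w : Equiv.Perm (Fin n)) : ℕ :=
  #{p : Fin n × Fin n | p.1 < p.2 ∧ w p.2 < w p.1}

/-- The long element `w_0`. -/
def longElement (n : ℕ) : Equiv.Perm (Fin n) := Fin.revPerm

/-- The Bruhat order: `u ≤ v` if `v` is reached from `u` by successive right multiplications by
reflections (transpositions), each of which increases the length. -/
def BruhatLE {n : ℕ} : Equiv.Perm (Fin n) → Equiv.Perm (Fin n) → Prop :=
  Relation.ReflTransGen fun u v =>
    ∃ i j : Fin n, i ≠ j ∧ v = u * Equiv.swap i j ∧ length u < length v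

/-- The pair `(i, j)` with `i ≠ j` stands for the root `e_i - e_j`; it is positive iff `i < j`,
and negative iff `j < i`. -/
def IsPosRoot {n : ℕ} (α : Fin n × Fin n) : Prop := α.1 < α.2

/-- See `IsPosRoot`. -/
def IsNegRoot {n : ℕ} (α : Fin n × Fin n) : Prop := α.2 < α.1

instance {n : ℕ} : DecidablePred (IsPosRoot (n := n)) := fun α => by
  unfold IsPosRoot
  infer_instance

instance {n : ℕ} : DecidablePred (IsNegRoot (n := n)) := fun α => by
  unfold IsNegRoot
  infer_instance

/-- The set of positive roots. -/
def posRoots (n : ℕ) : Finset (Fin n × Fin n) := {α | IsPosRoot α}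

/-- The action of permutations on roots, `u (e_i - e_j) = e_{u(i)} - e_{u(j)}`. -/
def rootAct {n : ℕ} (u : Equiv.Perm (Fin n)) (α : Fin n × Fin n) : Fin n × Fin n :=
  (u α.1, u α.2)

/-- The monomial `y^α = y_i / y_j` for `α = e_i - e_j`. -/
noncomputable def yPow {n : ℕ} (α : Fin n × Fin n) : RatField n := yVar α.1 / yVar α.2

end Weyl

end ColoredLattice

/-! The model is solvable. An R-matrix acting on the decorations of two adjacent rows satisfies a
Yang-Baxter equation with every column (`rMatrix_mul_columnPair`). Slid across the whole lattice, it
mixes the right boundaries `w` and `w * swap i j` on one side and acts by the scalar `x i - t * x j`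
on the uncolored left boundary. This gives a linear relation between the partition functions for
`w`, for `w * swap i j`, and for `w` with `x i` and `x j` exchanged (`partitionFunction_exchange`).
Solved for the second of these at `x i = y (u i)`, it is the recursion.

The vertical edges carry arbitrary sets of colors, yet the Yang-Baxter equation is a finite check.
Every color on the top edge contributes to a vertex weight a factor depending only on how it
compares with the left and right decorations (`vertexWeight_eq`). For a pair of vertices the product
of these factors is the same in all terms of the equation, so only the at most four colors on the
outer horizontal edges matter (`coreYangBaxter`).

For the right boundary `σ * longElement n` there is a single state, whose weight is a product; on
restriction some factor vanishes unless `u` is the long element.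

Vanishing and the diagonal values follow by induction on `x = σ⁻¹ * w` downwards from the long
element. The lifting property of the Bruhat order carries vanishing through the recursion
(`restrict_ZSquare_eq_zero`). On the diagonal, vanishing kills one of the two terms of the
recursion, and the coefficient of the other changes the factor of one root, the sign, and possibly
the power of `t` (`restrict_ZSquare_diagonal`). That power counts the common inversions of `w⁻¹ * σ`
and `σ`, so it is a natural number. -/

set_option linter.unusedSimpArgs false
set_option linter.unusedVariables false
-- The Yang-Baxter equation for at most four colors.
namespace ColoredLattice
open Finset
variable {K α : Type*} [CommRing K] [LinearOrder α]

/-- The factor that a color on the top edge contributes to the weight of a vertex with the given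
left decoration. -/
def spectLeft (t : K) : Option α → Option α → K
  | none, _ => 1
  | some _, none => -t
  | some e, some f => if f < e then -t else 1

/-- The factor that a color on the top edge contributes to the weight of a vertex with the given
right decoration. -/
def spectRight : Option α → Option α → K
  | none, _ => 1
  | some _, none => 1
  | some e, some f => if f < e then -1 else 1

/-- The indicator function of the bottom edge, from that of the top edge. -/
def afterVertex (p : α → K) (a b : Option α) (e : α) : K :=
  p e + (if a = some e then 1 else 0) - (if b = some e then 1 else 0)

/-- The weight of a vertex without the factors `spectLeft` and `spectRight`, where `p` is the
indicator function of the top edge and `s = t⁻¹`; it vanishes if the vertex is not admissible. -/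
def coreWeight (t s z : K) (p : α → K) : Option α → Option α → K
  | none, none => 1
  | none, some c => - s * p c
  | some c, none => (1 - p c) * (t - 1) * z
  | some c, some d => if c = d then 1 - z + (t - 1) * p c else
      (1 - p c) * p d * (if c < d then -(s * (t - 1) * z) else t - 1)

/-- The weight of two adjacent vertices in a column, without the factors `spectLeft` and
`spectRight` of the colors on the top edge. -/
def corePair (t s z₁ z₂ : K) (p : α → K) (a₁ a₂ b₁ b₂ : Option α) : K :=
  coreWeight t s z₁ p a₁ b₁ * coreWeight t s z₂ (afterVertex p a₁ b₁) a₂ b₂ *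
     (spectLeft t a₁ a₂ * spectRight a₁ b₂ * spectLeft s b₁ a₂ * spectRight b₁ b₂)

/-- The entries of the R-matrix that keep the order of the two decorations. -/
def rDiag (t x₁ x₂ : K) : Option α → Option α → K
  | none, none => x₁ - t * x₂
  | none, some _ => (1 - t) * x₂
  | some _, none => (1 - t) * x₁
  | some c, some d => if c = d then x₂ - t * x₁ else if c < d then (1 - t) * x₁ else (1 - t) * x₂

/-- The entries of the R-matrix that exchange the two decorations. -/
def rSwap (t x₁ x₂ : K) : Option α → Option α → K
  | none, none => 0
  | none, some _ => t * (x₂ - x₁)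
  | some _, none => x₂ - x₁
  | some c, some d => if c = d then 0 else if c < d then t * (x₂ - x₁) else (x₂ - x₁)

/-- Trichotomy with every negative consequence spelled out, so that `simp` can decide each
comparison in the weights. -/
theorem lt_or_eq_or_gt_full (a b : α) : (a < b ∧ ¬ b < a ∧ a ≠ b ∧ b ≠ a) ∨ a = b ∨
    (b < a ∧ ¬ a < b ∧ a ≠ b ∧ b ≠ a) := by
  rcases lt_trichotomy a b with h | h | h
  · exact .inl ⟨h, h.not_gt, h.ne, h.ne'⟩
  · exact .inr (.inl h)
  · exact .inr (.inr ⟨h, h.not_gt, h.ne', h.ne⟩)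

/-- The Yang-Baxter equation for `corePair`. -/
def CoreYangBaxter (t s z₁ z₂ : K) (p : α → K) (a₁ a₂ c₁ c₂ : Option α) : Prop :=
  rDiag t z₁ z₂ c₁ c₂ * corePair t s z₁ z₂ p a₁ a₂ c₁ c₂ +
    rSwap t z₁ z₂ c₁ c₂ * corePair t s z₁ z₂ p a₁ a₂ c₂ c₁ =
  rDiag t z₁ z₂ a₁ a₂ * corePair t s z₂ z₁ p a₁ a₂ c₁ c₂ +
    rSwap t z₁ z₂ a₂ a₁ * corePair t s z₂ z₁ p a₂ a₁ c₁ c₂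

/-- Sixteen cases follow, according to which of the four outer horizontal edges are colored (`n`
uncolored, `c` colored). Once the relative order of the colors is fixed, each is a polynomial
identity modulo `t * s = 1` and `p e * p e = p e`. Idempotency lets one identity cover both the
presence and the absence of a color on the top edge. -/
theorem coreYangBaxter_nnnn {t s : K} (z₁ z₂ : K) (h : t * s = 1) {p : α → K}
    (hp : ∀ e, p e * p e = p e) :
    CoreYangBaxter t s z₁ z₂ p none none none none := by
  clear hp
  simp only [*, lt_self_iff_false, reduceCtorEq, CoreYangBaxter, corePair, coreWeight, rDiag, rSwap, spectLeft,
    spectRight, afterVertex, Option.some.injEq, if_true, if_false]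

theorem coreYangBaxter_nnnc {t s : K} (z₁ z₂ : K) (h : t * s = 1) {p : α → K}
    (hp : ∀ e, p e * p e = p e) (d : α) :
    CoreYangBaxter t s z₁ z₂ p none none none (some d) := by
  have hd := hp d
  clear hp
  simp only [*, lt_self_iff_false, reduceCtorEq, CoreYangBaxter, corePair, coreWeight, rDiag, rSwap, spectLeft,
    spectRight, afterVertex, Option.some.injEq, if_true, if_false]
  grind

theorem coreYangBaxter_nncn {t s : K} (z₁ z₂ : K) (h : t * s = 1) {p : α → K}
    (hp : ∀ e, p e * p e = p e) (c : α) :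
    CoreYangBaxter t s z₁ z₂ p none none (some c) none := by
  have hc := hp c
  clear hp
  simp only [*, lt_self_iff_false, reduceCtorEq, CoreYangBaxter, corePair, coreWeight, rDiag, rSwap, spectLeft,
    spectRight, afterVertex, Option.some.injEq, if_true, if_false]
  grind

theorem coreYangBaxter_ncnn {t s : K} (z₁ z₂ : K) (h : t * s = 1) {p : α → K}
    (hp : ∀ e, p e * p e = p e) (b : α) :
    CoreYangBaxter t s z₁ z₂ p none (some b) none none := by
  have hb := hp b
  clear hp
  simp only [*, lt_self_iff_false, reduceCtorEq, CoreYangBaxter, corePair, coreWeight, rDiag, rSwap, spectLeft,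
    spectRight, afterVertex, Option.some.injEq, if_true, if_false]
  grind

theorem coreYangBaxter_cnnn {t s : K} (z₁ z₂ : K) (h : t * s = 1) {p : α → K}
    (hp : ∀ e, p e * p e = p e) (a : α) :
    CoreYangBaxter t s z₁ z₂ p (some a) none none none := by
  have ha := hp a
  clear hp
  simp only [*, lt_self_iff_false, reduceCtorEq, CoreYangBaxter, corePair, coreWeight, rDiag, rSwap, spectLeft,
    spectRight, afterVertex, Option.some.injEq, if_true, if_false]
  grind

theorem coreYangBaxter_nncc {t s : K} (z₁ z₂ : K) (h : t * s = 1) {p : α → K}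
    (hp : ∀ e, p e * p e = p e) (c d : α) :
    CoreYangBaxter t s z₁ z₂ p none none (some c) (some d) := by
  have hc := hp c
  have hd := hp d
  clear hp
  rcases lt_or_eq_or_gt_full c d with ⟨h1, _, _, _⟩ | h1 | ⟨h1, _, _, _⟩ <;>
  subst_vars <;>
  simp only [*, lt_self_iff_false, reduceCtorEq, CoreYangBaxter, corePair, coreWeight, rDiag, rSwap, spectLeft,
    spectRight, afterVertex, Option.some.injEq, if_true, if_false] <;> grind

theorem coreYangBaxter_ncnc {t s : K} (z₁ z₂ : K) (h : t * s = 1) {p : α → K}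
    (hp : ∀ e, p e * p e = p e) (b d : α) :
    CoreYangBaxter t s z₁ z₂ p none (some b) none (some d) := by
  have hb := hp b
  have hd := hp d
  clear hp
  rcases lt_or_eq_or_gt_full b d with ⟨h1, _, _, _⟩ | h1 | ⟨h1, _, _, _⟩ <;>
  subst_vars <;>
  simp only [*, lt_self_iff_false, reduceCtorEq, CoreYangBaxter, corePair, coreWeight, rDiag, rSwap, spectLeft,
    spectRight, afterVertex, Option.some.injEq, if_true, if_false] <;> grind

theorem coreYangBaxter_nccn {t s : K} (z₁ z₂ : K) (h : t * s = 1) {p : α → K}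
    (hp : ∀ e, p e * p e = p e) (b c : α) :
    CoreYangBaxter t s z₁ z₂ p none (some b) (some c) none := by
  have hb := hp b
  have hc := hp c
  clear hp
  rcases lt_or_eq_or_gt_full b c with ⟨h1, _, _, _⟩ | h1 | ⟨h1, _, _, _⟩ <;>
  subst_vars <;>
  simp only [*, lt_self_iff_false, reduceCtorEq, CoreYangBaxter, corePair, coreWeight, rDiag, rSwap, spectLeft,
    spectRight, afterVertex, Option.some.injEq, if_true, if_false] <;> grind

theorem coreYangBaxter_cnnc {t s : K} (z₁ z₂ : K) (h : t * s = 1) {p : α → K}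
    (hp : ∀ e, p e * p e = p e) (a d : α) :
    CoreYangBaxter t s z₁ z₂ p (some a) none none (some d) := by
  have ha := hp a
  have hd := hp d
  clear hp
  rcases lt_or_eq_or_gt_full a d with ⟨h1, _, _, _⟩ | h1 | ⟨h1, _, _, _⟩ <;>
  subst_vars <;>
  simp only [*, lt_self_iff_false, reduceCtorEq, CoreYangBaxter, corePair, coreWeight, rDiag, rSwap, spectLeft,
    spectRight, afterVertex, Option.some.injEq, if_true, if_false] <;> grind

theorem coreYangBaxter_cncn {t s : K} (z₁ z₂ : K) (h : t * s = 1) {p : α → K}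
    (hp : ∀ e, p e * p e = p e) (a c : α) :
    CoreYangBaxter t s z₁ z₂ p (some a) none (some c) none := by
  have ha := hp a
  have hc := hp c
  clear hp
  rcases lt_or_eq_or_gt_full a c with ⟨h1, _, _, _⟩ | h1 | ⟨h1, _, _, _⟩ <;>
  subst_vars <;>
  simp only [*, lt_self_iff_false, reduceCtorEq, CoreYangBaxter, corePair, coreWeight, rDiag, rSwap, spectLeft,
    spectRight, afterVertex, Option.some.injEq, if_true, if_false] <;> grind

theorem coreYangBaxter_ccnn {t s : K} (z₁ z₂ : K) (h : t * s = 1) {p : α → K}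
    (hp : ∀ e, p e * p e = p e) (a b : α) :
    CoreYangBaxter t s z₁ z₂ p (some a) (some b) none none := by
  have ha := hp a
  have hb := hp b
  clear hp
  rcases lt_or_eq_or_gt_full a b with ⟨h1, _, _, _⟩ | h1 | ⟨h1, _, _, _⟩ <;>
  subst_vars <;>
  simp only [*, lt_self_iff_false, reduceCtorEq, CoreYangBaxter, corePair, coreWeight, rDiag, rSwap, spectLeft,
    spectRight, afterVertex, Option.some.injEq, if_true, if_false] <;> grind

set_option maxHeartbeats 2000000 in
theorem coreYangBaxter_nccc {t s : K} (z₁ z₂ : K) (h : t * s = 1) {p : α → K}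
    (hp : ∀ e, p e * p e = p e) (b c d : α) :
    CoreYangBaxter t s z₁ z₂ p none (some b) (some c) (some d) := by
  have hb := hp b
  have hc := hp c
  have hd := hp d
  clear hp
  rcases lt_or_eq_or_gt_full b c with ⟨h1, _, _, _⟩ | h1 | ⟨h1, _, _, _⟩ <;>
  rcases lt_or_eq_or_gt_full b d with ⟨h2, _, _, _⟩ | h2 | ⟨h2, _, _, _⟩ <;>
  rcases lt_or_eq_or_gt_full c d with ⟨h3, _, _, _⟩ | h3 | ⟨h3, _, _, _⟩ <;> (try (exfalso; order)) <;>
  subst_vars <;>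
  simp only [*, lt_self_iff_false, reduceCtorEq, CoreYangBaxter, corePair, coreWeight, rDiag, rSwap, spectLeft,
    spectRight, afterVertex, Option.some.injEq, if_true, if_false] <;> grind

set_option maxHeartbeats 2000000 in
theorem coreYangBaxter_cncc {t s : K} (z₁ z₂ : K) (h : t * s = 1) {p : α → K}
    (hp : ∀ e, p e * p e = p e) (a c d : α) :
    CoreYangBaxter t s z₁ z₂ p (some a) none (some c) (some d) := by
  have ha := hp a
  have hc := hp c
  have hd := hp d
  clear hp
  rcases lt_or_eq_or_gt_full a c with ⟨h1, _, _, _⟩ | h1 | ⟨h1, _, _, _⟩ <;>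
  rcases lt_or_eq_or_gt_full a d with ⟨h2, _, _, _⟩ | h2 | ⟨h2, _, _, _⟩ <;>
  rcases lt_or_eq_or_gt_full c d with ⟨h3, _, _, _⟩ | h3 | ⟨h3, _, _, _⟩ <;> (try (exfalso; order)) <;>
  subst_vars <;>
  simp only [*, lt_self_iff_false, reduceCtorEq, CoreYangBaxter, corePair, coreWeight, rDiag, rSwap, spectLeft,
    spectRight, afterVertex, Option.some.injEq, if_true, if_false] <;> grind

set_option maxHeartbeats 2000000 in
theorem coreYangBaxter_ccnc {t s : K} (z₁ z₂ : K) (h : t * s = 1) {p : α → K}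
    (hp : ∀ e, p e * p e = p e) (a b d : α) :
    CoreYangBaxter t s z₁ z₂ p (some a) (some b) none (some d) := by
  have ha := hp a
  have hb := hp b
  have hd := hp d
  clear hp
  rcases lt_or_eq_or_gt_full a b with ⟨h1, _, _, _⟩ | h1 | ⟨h1, _, _, _⟩ <;>
  rcases lt_or_eq_or_gt_full a d with ⟨h2, _, _, _⟩ | h2 | ⟨h2, _, _, _⟩ <;>
  rcases lt_or_eq_or_gt_full b d with ⟨h3, _, _, _⟩ | h3 | ⟨h3, _, _, _⟩ <;> (try (exfalso; order)) <;>
  subst_vars <;>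
  simp only [*, lt_self_iff_false, reduceCtorEq, CoreYangBaxter, corePair, coreWeight, rDiag, rSwap, spectLeft,
    spectRight, afterVertex, Option.some.injEq, if_true, if_false] <;> grind

set_option maxHeartbeats 2000000 in
theorem coreYangBaxter_cccn {t s : K} (z₁ z₂ : K) (h : t * s = 1) {p : α → K}
    (hp : ∀ e, p e * p e = p e) (a b c : α) :
    CoreYangBaxter t s z₁ z₂ p (some a) (some b) (some c) none := by
  have ha := hp a
  have hb := hp b
  have hc := hp c
  clear hp
  rcases lt_or_eq_or_gt_full a b with ⟨h1, _, _, _⟩ | h1 | ⟨h1, _, _, _⟩ <;>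
  rcases lt_or_eq_or_gt_full a c with ⟨h2, _, _, _⟩ | h2 | ⟨h2, _, _, _⟩ <;>
  rcases lt_or_eq_or_gt_full b c with ⟨h3, _, _, _⟩ | h3 | ⟨h3, _, _, _⟩ <;> (try (exfalso; order)) <;>
  subst_vars <;>
  simp only [*, lt_self_iff_false, reduceCtorEq, CoreYangBaxter, corePair, coreWeight, rDiag, rSwap, spectLeft,
    spectRight, afterVertex, Option.some.injEq, if_true, if_false] <;> grind

set_option maxHeartbeats 2000000 in
theorem coreYangBaxter_cccc {t s : K} (z₁ z₂ : K) (h : t * s = 1) {p : α → K}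
    (hp : ∀ e, p e * p e = p e) (a b c d : α) :
    CoreYangBaxter t s z₁ z₂ p (some a) (some b) (some c) (some d) := by
  have ha := hp a
  have hb := hp b
  have hc := hp c
  have hd := hp d
  clear hp
  rcases lt_or_eq_or_gt_full a b with ⟨h1, _, _, _⟩ | h1 | ⟨h1, _, _, _⟩ <;>
  rcases lt_or_eq_or_gt_full a c with ⟨h2, _, _, _⟩ | h2 | ⟨h2, _, _, _⟩ <;>
  rcases lt_or_eq_or_gt_full b c with ⟨h3, _, _, _⟩ | h3 | ⟨h3, _, _, _⟩ <;> (try (exfalso; order)) <;>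
  rcases lt_or_eq_or_gt_full a d with ⟨h4, _, _, _⟩ | h4 | ⟨h4, _, _, _⟩ <;>
  rcases lt_or_eq_or_gt_full b d with ⟨h5, _, _, _⟩ | h5 | ⟨h5, _, _, _⟩ <;> (try (exfalso; order)) <;>
  rcases lt_or_eq_or_gt_full c d with ⟨h6, _, _, _⟩ | h6 | ⟨h6, _, _, _⟩ <;> (try (exfalso; order)) <;>
  subst_vars <;>
  simp only [*, lt_self_iff_false, reduceCtorEq, CoreYangBaxter, corePair, coreWeight, rDiag, rSwap, spectLeft,
    spectRight, afterVertex, Option.some.injEq, if_true, if_false] <;> grind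

theorem coreYangBaxter {t s : K} (z₁ z₂ : K) (h : t * s = 1) {p : α → K}
    (hp : ∀ e, p e * p e = p e) : ∀ a₁ a₂ c₁ c₂ : Option α, CoreYangBaxter t s z₁ z₂ p a₁ a₂ c₁ c₂
  | none, none, none, none => coreYangBaxter_nnnn z₁ z₂ h hp
  | none, none, none, some d => coreYangBaxter_nnnc z₁ z₂ h hp d
  | none, none, some c, none => coreYangBaxter_nncn z₁ z₂ h hp c
  | none, some b, none, none => coreYangBaxter_ncnn z₁ z₂ h hp b
  | some a, none, none, none => coreYangBaxter_cnnn z₁ z₂ h hp a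
  | none, none, some c, some d => coreYangBaxter_nncc z₁ z₂ h hp c d
  | none, some b, none, some d => coreYangBaxter_ncnc z₁ z₂ h hp b d
  | none, some b, some c, none => coreYangBaxter_nccn z₁ z₂ h hp b c
  | some a, none, none, some d => coreYangBaxter_cnnc z₁ z₂ h hp a d
  | some a, none, some c, none => coreYangBaxter_cncn z₁ z₂ h hp a c
  | some a, some b, none, none => coreYangBaxter_ccnn z₁ z₂ h hp a b
  | none, some b, some c, some d => coreYangBaxter_nccc z₁ z₂ h hp b c d
  | some a, none, some c, some d => coreYangBaxter_cncc z₁ z₂ h hp a c d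
  | some a, some b, none, some d => coreYangBaxter_ccnc z₁ z₂ h hp a b d
  | some a, some b, some c, none => coreYangBaxter_cccn z₁ z₂ h hp a b c
  | some a, some b, some c, some d => coreYangBaxter_cccc z₁ z₂ h hp a b c d

end ColoredLattice

/-! ### From core weights to the Yang-Baxter equation for a column with arbitrary color sets. -/

namespace ColoredLattice
open Finset
variable {K : Type*} [CommRing K] {r : ℕ}

/-- The indicator function of a set of colors. -/
def colorIndicator (K : Type*) [CommRing K] (S : Finset (Fin r)) (e : Fin r) : K :=
  if e ∈ S then 1 else 0

theorem colorIndicator_mul_self (S : Finset (Fin r)) (e : Fin r) :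
    colorIndicator K S e * colorIndicator K S e = colorIndicator K S e := by
  unfold colorIndicator; split_ifs <;> simp

/-- The joint factor of the colors of `S` in the weight of a vertex with left and right
decorations `a` and `b`. -/
def spectProd (t : K) (S : Finset (Fin r)) (a b : Option (Fin r)) : K :=
  (∏ e ∈ S, spectLeft t (some e) a) * ∏ e ∈ S, spectRight (some e) b

theorem prod_ite_pow {ι : Type*} (S : Finset ι) (P : ι → Prop) [DecidablePred P] (x : K) :
    ∏ e ∈ S, (if P e then x else 1) = x ^ #{e ∈ S | P e} := by
  rw [Finset.prod_ite]; simp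

/-- The exponents in the table count colors above, below or between the horizontal decorations, so
up to a core factor the weight is a product over the colors of `S`. A color leaving to the right is
itself counted in that product; the factor `s = t⁻¹` in `coreWeight` compensates for this. -/
theorem vertexWeight_eq {t s : K} (z : K) (h : t * s = 1) {a b : Option (Fin r)}
    {S T : Finset (Fin r)} (hadm : VertexAdmissible a S b T) :
    vertexWeight t z a S b = coreWeight t s z (colorIndicator K S) a b * spectProd t S a b := by
  have hneg (k : ℕ) : (-t) ^ k = (-1) ^ k * t ^ k := by rw [neg_pow]
  have hsplit (c : Fin r) (hc : c ∈ S) : #S = numBelow S c + numAbove S c + 1 := by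
    have h1 := Finset.card_filter_add_card_filter_not (s := S) (fun e => e < c)
    have h2 : (S.filter fun e => ¬ e < c) = insert c (S.filter fun e => c < e) := by
      ext e; simp only [mem_filter, mem_insert, not_lt]
      constructor
      · rintro ⟨h, h'⟩
        rcases h'.eq_or_lt with rfl | h'
        · exact .inl rfl
        · exact .inr ⟨h, h'⟩
      · rintro (rfl | ⟨h, h'⟩)
        · exact ⟨hc, le_rfl⟩
        · exact ⟨h, h'.le⟩
    rw [h2, card_insert_of_notMem (by simp)] at h1
    unfold numBelow numAbove; omega
  match a, b, hadm with
  | none, none, hadm =>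
    simp [vertexWeight, coreWeight, spectProd, spectLeft, spectRight]
  | none, some c, hadm =>
    have hc := hadm.1
    simp only [vertexWeight, coreWeight, spectProd, spectLeft, spectRight, prod_const,
      colorIndicator, hc, if_true, prod_ite_pow]
    have := hsplit c hc
    simp only [← numAbove.eq_1]
    rw [this]
    simp only [hneg, pow_add, pow_one]
    have h1 : ((-1 : K) ^ numAbove S c) * (-1) ^ numAbove S c = 1 := by
      rw [← mul_pow]; simp
    grind
  | some c, none, hadm =>
    have hc := hadm.1
    simp [vertexWeight, coreWeight, spectProd, spectLeft, spectRight,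
      colorIndicator, hc, prod_ite_pow, numAbove]
  | some c, some d, hadm =>
    rcases hadm with ⟨rfl, -⟩ | ⟨hne, hc, hd, -⟩
    · simp only [vertexWeight, coreWeight, spectProd, spectLeft, spectRight,
        colorIndicator, prod_ite_pow, numAbove, if_true, neg_pow t]
      have h1 : ((-1 : K) ^ #{e ∈ S | c < e}) * (-1) ^ #{e ∈ S | c < e} = 1 := by
        rw [← mul_pow]; simp
      split_ifs <;> grind
    · simp only [vertexWeight, coreWeight, spectProd, spectLeft, spectRight,
        colorIndicator, prod_ite_pow, hne, hc, hd, if_true, if_false]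
      simp only [← numAbove.eq_1]
      rcases lt_or_gt_of_ne hne with hlt | hgt
      · simp only [hlt, if_true]
        -- The extra `1` is `d` itself, which lies in `S` above `c`. In the opposite order there is
        -- no such term, because `c` is not in `S`.
        have h2 : numAbove S c = numBetween S c d + numAbove S d + 1 := by
          have h1 := hsplit d hd
          have h3 := Finset.card_filter_add_card_filter_not (s := S.filter fun e => c < e)
            (fun e => e < d)
          have h4 : ((S.filter fun e => c < e).filter fun e => ¬ e < d)
              = insert d (S.filter fun e => d < e) := by
            ext e; simp only [mem_filter, mem_insert, not_lt]
            constructor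
            · rintro ⟨⟨h, _⟩, h'⟩
              rcases h'.eq_or_lt with rfl | h'
              · exact .inl rfl
              · exact .inr ⟨h, h'⟩
            · rintro (rfl | ⟨h, h'⟩)
              · exact ⟨⟨hd, hlt⟩, le_rfl⟩
              · exact ⟨⟨h, hlt.trans h'⟩, h'.le⟩
          rw [h4, card_insert_of_notMem (by simp), filter_filter] at h3
          unfold numBetween numAbove; omega
        rw [h2]
        simp only [hneg, pow_add, pow_one]
        have h1 : ((-1 : K) ^ numAbove S d) * (-1) ^ numAbove S d = 1 := by
          rw [← mul_pow]; simp
        grind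
      · simp only [hgt.not_gt, if_false]
        have h2 : numAbove S d = numBetween S d c + numAbove S c := by
          have h3 := Finset.card_filter_add_card_filter_not (s := S.filter fun e => d < e)
            (fun e => e < c)
          have h4 : ((S.filter fun e => d < e).filter fun e => ¬ e < c)
              = (S.filter fun e => c < e) := by
            ext e; simp only [mem_filter, not_lt]
            constructor
            · rintro ⟨⟨h, _⟩, h'⟩
              exact ⟨h, lt_of_le_of_ne h' (fun h => hc (h ▸ ‹e ∈ S›))⟩
            · rintro ⟨h, h'⟩
              exact ⟨⟨h, hgt.trans h'⟩, h'.le⟩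
          rw [h4, filter_filter] at h3
          unfold numBetween numAbove; omega
        rw [h2]
        simp only [hneg, pow_add]
        have h1 : ((-1 : K) ^ numAbove S c) * (-1) ^ numAbove S c = 1 := by
          rw [← mul_pow]; simp
        grind

/-- The set on the bottom edge of an admissible vertex. -/
def bottomSet (a : Option (Fin r)) (S : Finset (Fin r)) (b : Option (Fin r)) : Finset (Fin r) :=
  if a = b then S else ({e | (e ∈ S ∨ a = some e) ∧ b ≠ some e} : Finset (Fin r))

/-- Whether a vertex with the given left, top and right decorations can be completed. -/
def Completable (a : Option (Fin r)) (S : Finset (Fin r)) (b : Option (Fin r)) : Prop :=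
  a = b ∨ (∀ c, a = some c → c ∉ S) ∧ ∀ d, b = some d → d ∈ S

theorem vertexAdmissible_iff {a b : Option (Fin r)} {S T : Finset (Fin r)} :
    VertexAdmissible a S b T ↔ Completable a S b ∧ T = bottomSet a S b := by
  match a, b with
  | none, none => simp [VertexAdmissible, Completable, bottomSet]
  | none, some c =>
    simp only [VertexAdmissible, Completable, bottomSet]
    simp only [reduceCtorEq, false_or, if_false, Option.some.injEq, forall_eq', or_false]
    have : S.erase c = ({e | e ∈ S ∧ some c ≠ some e} : Finset _) := by ext; simp; grind
    simp [this]
  | some c, none =>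
    simp only [VertexAdmissible, Completable, bottomSet]
    simp only [reduceCtorEq, false_or, if_false, Option.some.injEq, forall_eq']
    have : insert c S = ({e | (e ∈ S ∨ c = e) ∧ none ≠ some e} : Finset _) := by ext; simp; grind
    simp [this]
  | some c, some d =>
    simp only [VertexAdmissible, Completable, bottomSet]
    simp only [Option.some.injEq, forall_eq']
    have : (insert c S).erase d = ({e | (e ∈ S ∨ c = e) ∧ some d ≠ some e} : Finset _) := by
      ext; simp; grind
    by_cases h : c = d
    · simp [h]
    · simp [h, this, and_assoc]

/-- The factors `p d` and `1 - p c` detect a missing outgoing color and a duplicated incoming color,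
so admissibility need not be imposed separately. -/
theorem coreWeight_eq_zero {t s z : K} {a b : Option (Fin r)} {S : Finset (Fin r)}
    (h : ¬ Completable a S b) : coreWeight t s z (colorIndicator K S) a b = 0 := by
  match a, b with
  | none, none => simp [Completable] at h
  | none, some c =>
    simp [Completable] at h
    simp [coreWeight, colorIndicator, h]
  | some c, none =>
    simp [Completable] at h
    simp [coreWeight, colorIndicator, h]
  | some c, some d =>
    simp only [Completable, Option.some.injEq, forall_eq'] at h
    push Not at h
    obtain ⟨h1, h2⟩ := h
    simp only [coreWeight, colorIndicator, h1, if_false]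
    by_cases hc : c ∈ S
    · simp [hc]
    · simp [h2 hc]

/-- The weight of a vertex, or `0` if the vertex is not admissible. -/
def vertexEntry (t z : K) (a : Option (Fin r)) (S : Finset (Fin r)) (b : Option (Fin r))
    (T : Finset (Fin r)) : K :=
  if VertexAdmissible a S b T then vertexWeight t z a S b else 0

theorem vertexEntry_eq {t s : K} (z : K) (h : t * s = 1) (a b : Option (Fin r))
    (S T : Finset (Fin r)) : vertexEntry t z a S b T =
      if T = bottomSet a S b then
        coreWeight t s z (colorIndicator K S) a b * spectProd t S a b else 0 := by
  unfold vertexEntry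
  by_cases hT : T = bottomSet a S b
  · by_cases hc : Completable a S b
    · have := vertexAdmissible_iff.2 ⟨hc, hT⟩
      rw [if_pos this, if_pos hT, vertexWeight_eq z h this]
    · rw [if_neg (fun h' => hc (vertexAdmissible_iff.1 h').1), if_pos hT, coreWeight_eq_zero hc,
        zero_mul]
  · rw [if_neg (fun h' => hT (vertexAdmissible_iff.1 h').2), if_neg hT]

theorem colorIndicator_bottomSet {a b : Option (Fin r)} {S : Finset (Fin r)}
    (h : Completable a S b) :
    colorIndicator K (bottomSet a S b) = afterVertex (colorIndicator K S) a b := by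
  funext e
  unfold colorIndicator afterVertex bottomSet
  rcases h with rfl | ⟨h1, h2⟩
  · simp
  · have h3 := h1 e
    have h4 := h2 e
    by_cases ha : a = some e <;> by_cases hb : b = some e
    · grind
    · have : a ≠ b := by grind
      simp_all
    · have : a ≠ b := by grind
      simp_all
    · by_cases hab : a = b
      · simp_all
      · simp_all

/-- The color `a` enters the set and `b` leaves it; since `g` is the inverse of `f`, leaving amounts
to multiplying by `g b`. -/
theorem prod_bottomSet {a b : Option (Fin r)} {S : Finset (Fin r)}
    (h : Completable a S b) (f g : Option (Fin r) → K) (hf : f none = 1) (hg : g none = 1)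
    (hfg : ∀ e, f e * g e = 1) :
    ∏ e ∈ bottomSet a S b, f (some e) = (∏ e ∈ S, f (some e)) * (f a * g b) := by
  by_cases hab : a = b
  · subst hab; simp [bottomSet, hfg]
  have h' : VertexAdmissible a S b (bottomSet a S b) := vertexAdmissible_iff.2 ⟨h, rfl⟩
  revert h'
  generalize bottomSet a S b = T
  intro h'
  match a, b with
  | none, none => simp at hab
  | none, some c =>
    obtain ⟨h1, rfl⟩ := h'
    rw [← Finset.mul_prod_erase S _ h1, hf]
    linear_combination -(∏ e ∈ S.erase c, f (some e)) * hfg (some c)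
  | some c, none =>
    obtain ⟨h1, rfl⟩ := h'
    rw [Finset.prod_insert h1, hg]; ring
  | some c, some d =>
    obtain ⟨h1, -⟩ | ⟨h1, h2, h3, rfl⟩ := h'
    · simp [h1] at hab
    · have h4 : d ∈ insert c S := by simp [h3]
      have h5 := Finset.mul_prod_erase (insert c S) (fun e => f (some e)) h4
      rw [Finset.prod_insert h2] at h5
      linear_combination g (some d) * h5 - (∏ e ∈ (insert c S).erase d, f (some e)) * hfg (some d)

theorem spectLeft_mul_spectLeft {t s : K} (h : t * s = 1) (e f : Option (Fin r)) :
    spectLeft t e f * spectLeft s e f = 1 := by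
  match e, f with
  | none, _ => simp [spectLeft]
  | some e, none => simp [spectLeft, h]
  | some e, some f => simp only [spectLeft]; split_ifs <;> simp [h]

theorem spectRight_mul_self (e f : Option (Fin r)) :
    spectRight (K := K) e f * spectRight e f = 1 := by
  match e, f with
  | none, _ => simp [spectRight]
  | some e, none => simp [spectRight]
  | some e, some f => simp only [spectRight]; split_ifs <;> simp

theorem spectProd_bottomSet {t s : K} (ht : t * s = 1) {a₁ b₁ : Option (Fin r)}
    {S : Finset (Fin r)} (h : Completable a₁ S b₁) (a₂ b₂ : Option (Fin r)) :
    spectProd t (bottomSet a₁ S b₁) a₂ b₂ = spectProd t S a₂ b₂ *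
      (spectLeft t a₁ a₂ * spectRight a₁ b₂ * spectLeft s b₁ a₂ * spectRight b₁ b₂) := by
  unfold spectProd
  rw [prod_bottomSet h (fun e => spectLeft t e a₂) (fun e => spectLeft s e a₂) rfl rfl
      (fun e => spectLeft_mul_spectLeft ht e a₂),
    prod_bottomSet h (fun e => spectRight e b₂) (fun e => spectRight e b₂) rfl rfl
      (fun e => spectRight_mul_self e b₂)]
  ring

/-- Conservation of colors at a pair of vertices in one column. -/
def PairConserved (a b : Option (Fin r) × Option (Fin r)) (S U : Finset (Fin r)) : Prop :=
  ∀ e, colorIndicator ℤ U e + ((if b.1 = some e then 1 else 0) + if b.2 = some e then 1 else 0) =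
    colorIndicator ℤ S e + ((if a.1 = some e then 1 else 0) + if a.2 = some e then 1 else 0)

theorem colorIndicator_injective : Function.Injective (colorIndicator (r := r) ℤ) := by
  intro S T h
  ext e
  have := congrFun h e
  unfold colorIndicator at this
  split_ifs at this <;> simp_all

/-- Conservation of colors determines the bottom edge of the pair. Unlike the iterated `bottomSet`,
it is visibly symmetric under exchanging the two entries of `a` or of `b`, hence is the same
condition in all four terms of the Yang-Baxter equation. -/
theorem eq_bottomSet_bottomSet_iff {a b : Option (Fin r) × Option (Fin r)} {S U : Finset (Fin r)}
    (h₁ : Completable a.1 S b.1) (h₂ : Completable a.2 (bottomSet a.1 S b.1) b.2) :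
    U = bottomSet a.2 (bottomSet a.1 S b.1) b.2 ↔ PairConserved a b S U := by
  rw [← colorIndicator_injective.eq_iff, colorIndicator_bottomSet h₂, colorIndicator_bottomSet h₁,
    funext_iff]
  refine forall_congr' fun e => ?_
  unfold afterVertex
  constructor <;> intro h <;> linarith

/-- The weights of the pairs of adjacent vertices in one column, as a matrix from left
to right decorations. -/
def columnPair (t z₁ z₂ : K) (S U : Finset (Fin r)) :
    Matrix (Option (Fin r) × Option (Fin r)) (Option (Fin r) × Option (Fin r)) K :=
  Matrix.of fun b a => ∑ T, vertexEntry t z₁ a.1 S b.1 T * vertexEntry t z₂ a.2 T b.2 U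

open Classical in
theorem columnPair_apply {t s : K} (ht : t * s = 1) (z₁ z₂ : K) (S U : Finset (Fin r))
    (a b : Option (Fin r) × Option (Fin r)) :
    columnPair t z₁ z₂ S U b a = if PairConserved a b S U then
      corePair t s z₁ z₂ (colorIndicator K S) a.1 a.2 b.1 b.2 *
        (spectProd t S a.1 b.1 * spectProd t S a.2 b.2) else 0 := by
  simp only [columnPair, Matrix.of_apply]
  rw [Finset.sum_eq_single (bottomSet a.1 S b.1)]
  rotate_left
  · intro T _ hT
    rw [vertexEntry_eq z₁ ht, if_neg hT, zero_mul]
  · simp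
  rw [vertexEntry_eq z₁ ht, if_pos rfl, vertexEntry_eq z₂ ht, corePair]
  by_cases h₁ : Completable a.1 S b.1
  · rw [← colorIndicator_bottomSet h₁]
    by_cases h₂ : Completable a.2 (bottomSet a.1 S b.1) b.2
    · simp only [eq_bottomSet_bottomSet_iff h₁ h₂, spectProd_bottomSet ht h₁]
      split_ifs <;> ring
    · simp [coreWeight_eq_zero h₂]
  · simp [coreWeight_eq_zero h₁]

/-- The R-matrix. -/
def rMatrix (t x₁ x₂ : K) :
    Matrix (Option (Fin r) × Option (Fin r)) (Option (Fin r) × Option (Fin r)) K :=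
  Matrix.of fun c b => (if b = c then rDiag t x₁ x₂ c.1 c.2 else 0) +
    if b = c.swap then rSwap t x₁ x₂ c.1 c.2 else 0

theorem rMatrix_mul_apply (t x₁ x₂ : K)
    (M : Matrix (Option (Fin r) × Option (Fin r)) (Option (Fin r) × Option (Fin r)) K)
    (c a : Option (Fin r) × Option (Fin r)) :
    (rMatrix (r := r) t x₁ x₂ * M) c a =
      rDiag t x₁ x₂ c.1 c.2 * M c a + rSwap t x₁ x₂ c.1 c.2 * M c.swap a := by
  simp [Matrix.mul_apply, rMatrix, add_mul, Finset.sum_add_distrib]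

theorem mul_rMatrix_apply (t x₁ x₂ : K)
    (M : Matrix (Option (Fin r) × Option (Fin r)) (Option (Fin r) × Option (Fin r)) K)
    (c a : Option (Fin r) × Option (Fin r)) :
    (M * rMatrix (r := r) t x₁ x₂) c a =
      rDiag t x₁ x₂ a.1 a.2 * M c a + rSwap t x₁ x₂ a.2 a.1 * M c a.swap := by
  have (b : Option (Fin r) × Option (Fin r)) : a = b.swap ↔ b = a.swap := by
    constructor <;> rintro rfl <;> simp
  simp [Matrix.mul_apply, rMatrix, mul_add, Finset.sum_add_distrib, this]
  ring

/-- The product of the two `spectProd` factors splits into one factor for each of the four outer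
edges, so it is unchanged when the two left or the two right decorations are exchanged. It factors
out and leaves `coreYangBaxter`. -/
theorem rMatrix_mul_columnPair {t s : K} (ht : t * s = 1) (z₁ z₂ : K) (S U : Finset (Fin r)) :
    rMatrix (r := r) t z₁ z₂ * columnPair t z₁ z₂ S U = columnPair t z₂ z₁ S U * rMatrix (r := r) t z₁ z₂ := by
  classical
  ext c a
  rw [rMatrix_mul_apply, mul_rMatrix_apply]
  simp only [columnPair_apply ht]
  have h1 : PairConserved a c.swap S U ↔ PairConserved a c S U :=
    forall_congr' fun e => by rw [add_comm (ite (c.swap.1 = _) _ _)]; rfl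
  have h2 : PairConserved a.swap c S U ↔ PairConserved a c S U :=
    forall_congr' fun e => by rw [add_comm (ite (a.swap.1 = _) _ _)]; rfl
  simp only [h1, h2]
  split_ifs
  · have := coreYangBaxter z₁ z₂ ht (colorIndicator_mul_self S) a.1 a.2 c.1 c.2
    unfold CoreYangBaxter at this
    simp only [Prod.fst_swap, Prod.snd_swap, spectProd] at *
    linear_combination ((∏ e ∈ S, spectLeft t (some e) a.1) * (∏ e ∈ S, spectRight (some e) c.1) *
      ((∏ e ∈ S, spectLeft t (some e) a.2) * ∏ e ∈ S, spectRight (some e) c.2)) * this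
  · simp

end ColoredLattice

/-! ### Transfer matrices and the train argument. -/

namespace ColoredLattice
open Finset

section ListProducts

/-- An entry of a matrix product is a sum over paths of intermediate indices; here these are the
decorations of the interior edges. -/
theorem ofFn_prod_apply {K ι : Type*} [CommRing K] [Fintype ι] [DecidableEq ι] {n : ℕ}
    (A : Fin n → Matrix ι ι K) (a b : ι) :
    (List.ofFn A).prod a b = ∑ p : Fin (n + 1) → ι,
      if p 0 = a ∧ p (Fin.last n) = b then ∏ i : Fin n, A i (p i.castSucc) (p i.succ) else 0 := by
  induction n generalizing a with
  | zero =>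
    rw [← (Equiv.funUnique (Fin 1) ι).symm.sum_comp]
    simp only [List.ofFn_zero, List.prod_nil, Matrix.one_apply, univ_eq_empty, prod_empty]
    by_cases h : a = b
    · subst h
      rw [Finset.sum_eq_single a] <;> simp +contextual
    · rw [if_neg h, Finset.sum_eq_zero]
      intro x _
      rw [if_neg]
      simp; grind
  | succ n ih =>
    rw [List.ofFn_succ, List.prod_cons, Matrix.mul_apply]
    simp only [ih]
    rw [← (Fin.consEquiv (fun _ => ι)).sum_comp, Fintype.sum_prod_type]
    simp only [Fin.consEquiv_apply, Fin.cons_zero, ← Fin.succ_last, Fin.cons_succ,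
      Fin.prod_univ_succ, Fin.castSucc_zero, ← Fin.succ_castSucc]
    rw [Finset.sum_eq_single (f := fun x => ∑ y : Fin (n + 1) → ι, _) a (by simp +contextual) (by simp)]
    simp only [Finset.mul_sum]
    rw [Finset.sum_comm]
    refine Finset.sum_congr rfl fun p _ => ?_
    rw [Finset.sum_eq_single (p 0)] <;> simp +contextual [eq_comm]

theorem sum_ofFn_prod {R τ : Type*} [Semiring R] [Fintype τ] [DecidableEq τ] {n : ℕ}
    (F : Fin n → τ → R) :
    ∑ T : Fin n → τ, (List.ofFn fun j => F j (T j)).prod = (List.ofFn fun j => ∑ c, F j c).prod := by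
  induction n with
  | zero => simp
  | succ n ih =>
    rw [← (Fin.consEquiv (fun _ => τ)).sum_comp, Fintype.sum_prod_type]
    simp only [Fin.consEquiv_apply, List.ofFn_succ, List.prod_cons, Fin.cons_zero, Fin.cons_succ,
      ← ih, Finset.sum_mul_sum]

open scoped Kronecker in
theorem ofFn_prod_kronecker {K ι κ : Type*} [CommRing K] [Fintype ι] [DecidableEq ι] [Fintype κ]
    [DecidableEq κ] {n : ℕ} (A : Fin n → Matrix ι ι K) (B : Fin n → Matrix κ κ K) :
    (List.ofFn A).prod ⊗ₖ (List.ofFn B).prod = (List.ofFn fun j => A j ⊗ₖ B j).prod := by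
  induction n with
  | zero => simp
  | succ n ih => simp only [List.ofFn_succ, List.prod_cons, Matrix.mul_kronecker_mul, ih]

theorem semiconjBy_ofFn_prod {R : Type*} [Monoid R] {n : ℕ} {r : R} {F G : Fin n → R}
    (h : ∀ j, SemiconjBy r (F j) (G j)) :
    SemiconjBy r (List.ofFn F).prod (List.ofFn G).prod := by
  induction n with
  | zero => simp
  | succ n ih =>
    simp only [List.ofFn_succ, List.prod_cons]
    exact (h 0).mul_right (ih fun j => h j.succ)

theorem ofFn_prod_adjacent {K R : Type*} [CommRing K] [Ring R] [Algebra K R] {n : ℕ}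
    (F G H : Fin n → R) (a b c : K) (i j : Fin n) (hij : (j : ℕ) = i + 1)
    (hFG : ∀ k, k ≠ i → k ≠ j → F k = G k) (hFH : ∀ k, k ≠ i → k ≠ j → F k = H k)
    (h : a • (F i * F j) + b • (G i * G j) = c • (H i * H j)) :
    a • (List.ofFn F).prod + b • (List.ofFn G).prod = c • (List.ofFn H).prod := by
  induction n with
  | zero => exact i.elim0
  | succ n ih =>
    simp only [List.ofFn_succ, List.prod_cons]
    refine Fin.cases (fun hij h hFG hFH => ?_) (fun i hij h hFG hFH => ?_) i hij h hFG hFH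
    · match n with
      | 0 => exact absurd hij (by simp)
      | n + 1 =>
        have hj : j = Fin.succ 0 := by ext; simpa using hij
        subst hj
        simp only [List.ofFn_succ, List.prod_cons]
        have hG : (fun k : Fin n => F k.succ.succ) = fun k => G k.succ.succ :=
          funext fun k => hFG _ (Fin.succ_ne_zero _) fun h => Fin.succ_ne_zero _ (Fin.succ_injective _ h)
        have hH : (fun k : Fin n => F k.succ.succ) = fun k => H k.succ.succ :=
          funext fun k => hFH _ (Fin.succ_ne_zero _) fun h => Fin.succ_ne_zero _ (Fin.succ_injective _ h)
        rw [← hG, ← hH]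
        simp only [← mul_assoc, ← smul_mul_assoc, ← add_mul]
        simp only [smul_mul_assoc]
        rw [h, smul_mul_assoc]
    · have hj : j ≠ 0 := by rintro rfl; simp at hij
      obtain ⟨j, rfl⟩ := Fin.exists_succ_eq.2 hj
      have h0 : F 0 = G 0 := hFG _ (Fin.succ_ne_zero _).symm (Fin.succ_ne_zero _).symm
      have h1 : F 0 = H 0 := hFH _ (Fin.succ_ne_zero _).symm (Fin.succ_ne_zero _).symm
      rw [← h0, ← h1, ← mul_smul_comm, ← mul_smul_comm, ← mul_smul_comm, ← mul_add]
      congr 1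
      exact ih _ _ _ i j (by simpa using hij) (fun k hk hk' => hFG _ (by simpa) (by simpa))
        (fun k hk hk' => hFH _ (by simpa) (by simpa)) h

end ListProducts

variable {K : Type*} [CommRing K] {n N r : ℕ}

/-- The weight of a row with right decoration `b` and uncolored left edge, as a matrix from
the top to the bottom decorations. -/
def rowMatrix (t : K) (z : Fin N → K) (b : Option (Fin r)) :
    Matrix (Fin N → Finset (Fin r)) (Fin N → Finset (Fin r)) K :=
  Matrix.of fun S T =>
    (List.ofFn fun j => Matrix.of fun b a => vertexEntry t (z j) a (S j) b (T j)).prod b none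

/-- Expanding the rows over horizontal edges and their product over vertical edges gives a sum over
all decorated lattices; `vertexEntry` discards the inadmissible ones. -/
theorem partitionFunction_eq_prod (t : K) (z : Fin n → Fin N → K) (top : Fin N → Finset (Fin r))
    (right : Fin n → Option (Fin r)) :
    partitionFunction t z top right =
      (List.ofFn fun i => rowMatrix t (z i) (right i)).prod top fun _ => ∅ := by
  rw [ofFn_prod_apply]
  simp only [rowMatrix, Matrix.of_apply, ofFn_prod_apply, Finset.prod_univ_sum,
    Fintype.piFinset_univ]
  unfold partitionFunction
  rw [Finset.sum_filter, Fintype.sum_prod_type]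
  refine Finset.sum_congr rfl fun v _ => ?_
  have hv : (v 0 = top ∧ v (Fin.last n) = fun _ => ∅) ↔
      (∀ j, v 0 j = top j) ∧ ∀ j, v (Fin.last n) j = ∅ := by simp [funext_iff]
  by_cases h : (v 0 = top ∧ v (Fin.last n) = fun _ => ∅)
  · rw [if_pos h]
    rw [hv] at h
    refine Finset.sum_congr rfl fun p _ => ?_
    by_cases hp : ∀ i, p i 0 = right i ∧ p i (Fin.last N) = none
    · rw [Finset.prod_congr rfl (fun i _ => if_pos (hp i))]
      by_cases ha : ∀ i j, VertexAdmissible (p i j.succ) (v i.castSucc j) (p i j.castSucc)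
          (v i.succ j)
      · rw [if_pos ⟨h.1, h.2, fun i => (hp i).1, fun i => (hp i).2, ha⟩]
        refine Finset.prod_congr rfl fun i _ => Finset.prod_congr rfl fun j _ => ?_
        rw [vertexEntry, if_pos (ha i j)]
      · rw [if_neg fun h' => ha h'.2.2.2.2]
        push Not at ha
        obtain ⟨i, j, hij⟩ := ha
        exact (Finset.prod_eq_zero (mem_univ i) (Finset.prod_eq_zero (mem_univ j)
          (if_neg hij))).symm
    · rw [if_neg fun h' => hp fun i => ⟨h'.2.2.1 i, h'.2.2.2.1 i⟩]
      push Not at hp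
      obtain ⟨i, hi⟩ := hp
      exact (Finset.prod_eq_zero (mem_univ i) (if_neg fun h' => hi h'.1 h'.2)).symm
  · rw [if_neg h]
    refine Finset.sum_eq_zero fun p _ => if_neg fun h' => h (hv.2 ⟨h'.1, h'.2.1⟩)

open scoped Kronecker in
-- Two rows are regrouped by columns: a product of Kronecker products is the Kronecker product of
-- the products, and the sum over the edges between the rows distributes over the columns.
theorem rowMatrix_mul_rowMatrix_apply (t : K) (z₁ z₂ : Fin N → K) (b₁ b₂ : Option (Fin r))
    (S U : Fin N → Finset (Fin r)) :
    (rowMatrix t z₁ b₁ * rowMatrix t z₂ b₂) S U =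
      (List.ofFn fun j => columnPair t (z₁ j) (z₂ j) (S j) (U j)).prod (b₁, b₂) (none, none) := by
  have h (j : Fin N) : columnPair t (z₁ j) (z₂ j) (S j) (U j) = ∑ T,
      (Matrix.of fun b a => vertexEntry t (z₁ j) a (S j) b T) ⊗ₖ
        (Matrix.of fun b a => vertexEntry t (z₂ j) a T b (U j)) := by
    ext b a
    rw [Matrix.sum_apply]
    rfl
  simp only [h]
  rw [← sum_ofFn_prod, Matrix.mul_apply, Matrix.sum_apply]
  refine Finset.sum_congr rfl fun T _ => ?_
  rw [← ofFn_prod_kronecker]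
  rfl

/-- By homogeneity, the R-matrix depends on the column only through a scalar. After cancellation of
that unit, one R-matrix serves all columns. -/
theorem rMatrix_mul (t x₁ x₂ v : K) :
    rMatrix (r := r) t (x₁ * v) (x₂ * v) = v • rMatrix t x₁ x₂ := by
  have hD (c₁ c₂ : Option (Fin r)) :
      rDiag t (x₁ * v) (x₂ * v) c₁ c₂ = v * rDiag t x₁ x₂ c₁ c₂ := by
    match c₁, c₂ with
    | none, none => simp only [rDiag]; ring
    | none, some _ => simp only [rDiag]; ring
    | some _, none => simp only [rDiag]; ring
    | some c, some d => simp only [rDiag]; split_ifs <;> ring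
  have hS (c₁ c₂ : Option (Fin r)) :
      rSwap t (x₁ * v) (x₂ * v) c₁ c₂ = v * rSwap t x₁ x₂ c₁ c₂ := by
    match c₁, c₂ with
    | none, none => simp only [rSwap]; ring
    | none, some _ => simp only [rSwap]; ring
    | some _, none => simp only [rSwap]; ring
    | some c, some d => simp only [rSwap]; split_ifs <;> ring
  ext c b
  simp only [rMatrix, Matrix.of_apply, hD, hS, Matrix.smul_apply, smul_eq_mul]
  split_ifs <;> ring

/-- The train argument: the R-matrix enters at the right edges, passes every column while exchanging
`x₁` and `x₂`, and leaves at the left edges. There both decorations are uncolored, and it acts by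
`x₁ - t * x₂`. -/
theorem rowMatrix_exchange {t s : K} (ht : t * s = 1) (x₁ x₂ : K) {v : Fin N → K}
    (hv : ∀ j, IsUnit (v j)) (b₁ b₂ : Option (Fin r)) :
    rDiag t x₁ x₂ b₁ b₂ • (rowMatrix t (fun j => x₁ * v j) b₁ * rowMatrix t (fun j => x₂ * v j) b₂) +
      rSwap t x₁ x₂ b₁ b₂ •
        (rowMatrix t (fun j => x₁ * v j) b₂ * rowMatrix t (fun j => x₂ * v j) b₁) =
    (x₁ - t * x₂) •
      (rowMatrix t (fun j => x₂ * v j) b₁ * rowMatrix t (fun j => x₁ * v j) b₂) := by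
  ext S U
  simp only [Matrix.add_apply, Matrix.smul_apply, smul_eq_mul, rowMatrix_mul_rowMatrix_apply]
  have h : SemiconjBy (rMatrix (r := r) t x₁ x₂)
      (List.ofFn fun j => columnPair t (x₁ * v j) (x₂ * v j) (S j) (U j)).prod
      (List.ofFn fun j => columnPair t (x₂ * v j) (x₁ * v j) (S j) (U j)).prod := by
    refine semiconjBy_ofFn_prod fun j => ?_
    have := rMatrix_mul_columnPair ht (x₁ * v j) (x₂ * v j) (S j) (U j)
    rw [rMatrix_mul, smul_mul_assoc, mul_smul_comm] at this
    exact (hv j).smul_left_cancel.1 this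
  have h' := congrFun (congrFun h.eq (b₁, b₂)) (none, none)
  rw [rMatrix_mul_apply, mul_rMatrix_apply] at h'
  simpa [rDiag, rSwap] using h'

theorem partitionFunction_exchange {t s : K} (ht : t * s = 1) {v : Fin N → K}
    (hv : ∀ j, IsUnit (v j)) (x : Fin n → K) (top : Fin N → Finset (Fin r))
    (b : Fin n → Option (Fin r)) {i j : Fin n} (hij : (j : ℕ) = i + 1) :
    rDiag t (x i) (x j) (b i) (b j) * partitionFunction t (fun i j => x i * v j) top b +
      rSwap t (x i) (x j) (b i) (b j) *
        partitionFunction t (fun i j => x i * v j) top (b ∘ Equiv.swap i j) =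
    (x i - t * x j) *
      partitionFunction t (fun k j' => x (Equiv.swap i j k) * v j') top b := by
  simp only [partitionFunction_eq_prod]
  have h := ofFn_prod_adjacent
    (fun i => rowMatrix t (fun j => x i * v j) (b i))
    (fun k => rowMatrix t (fun j' => x k * v j') (b (Equiv.swap i j k)))
    (fun k => rowMatrix t (fun j' => x (Equiv.swap i j k) * v j') (b k))
    (rDiag t (x i) (x j) (b i) (b j)) (rSwap t (x i) (x j) (b i) (b j)) (x i - t * x j) i j hij
    (fun k hk hk' => by simp only [Equiv.swap_apply_of_ne_of_ne hk hk'])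
    (fun k hk hk' => by simp only [Equiv.swap_apply_of_ne_of_ne hk hk'])
    (by
      simp only [Equiv.swap_apply_left, Equiv.swap_apply_right]
      exact rowMatrix_exchange ht (x i) (x j) hv (b i) (b j))
  exact congrFun (congrFun h top) fun _ => ∅

end ColoredLattice

/-! ### Length, Bruhat order and inversions in the symmetric group. -/

namespace ColoredLattice
open Finset
variable {n : ℕ}

theorem swap_lt_swap {i j : Fin n} (hij : (j : ℕ) = i + 1) {p q : Fin n} (hpq : p < q)
    (h : ¬ (p = i ∧ q = j)) : Equiv.swap i j p < Equiv.swap i j q := by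
  simp only [Equiv.swap_apply_def, Fin.ext_iff, Fin.lt_def] at *
  split_ifs <;> omega

/-- An adjacent transposition reverses only the pair `(i, j)`, so it carries the inversions of `x`
bijectively to those of the product other than `(i, j)`. -/
theorem length_mul_swap_of_lt {i j : Fin n} (hij : (j : ℕ) = i + 1) {x : Equiv.Perm (Fin n)}
    (h : x i < x j) : length (x * Equiv.swap i j) = length x + 1 := by
  set s := Equiv.swap i j with hs
  have hlt : i < j := by rw [Fin.lt_def]; omega
  have hss (p : Fin n) : s (s p) = p := by simp [hs]
  have hsi : s i = j := Equiv.swap_apply_left i j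
  have hsj : s j = i := Equiv.swap_apply_right i j
  have hset : ({p : Fin n × Fin n | p.1 < p.2 ∧ (x * s) p.2 < (x * s) p.1} : Finset _) =
      insert (i, j) (image (Prod.map s s)
        ({p : Fin n × Fin n | p.1 < p.2 ∧ x p.2 < x p.1} : Finset _)) := by
    ext ⟨p, q⟩
    simp only [mem_filter, mem_univ, true_and, mem_insert, mem_image, Prod.mk.injEq, Prod.exists,
      Prod.map_apply]
    simp only [Equiv.Perm.mul_apply]
    constructor
    · rintro ⟨h1, h2⟩
      by_cases hp : p = i ∧ q = j
      · exact .inl hp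
      · exact .inr ⟨s p, s q, ⟨swap_lt_swap hij h1 hp, h2⟩, hss p, hss q⟩
    · rintro (⟨rfl, rfl⟩ | ⟨a, b, ⟨h1, h2⟩, rfl, rfl⟩)
      · rw [hsi, hsj]; exact ⟨hlt, h⟩
      · refine ⟨swap_lt_swap hij h1 ?_, by simpa [hss] using h2⟩
        rintro ⟨rfl, rfl⟩
        exact absurd h2 h.not_gt
  unfold length
  rw [hset, card_insert_of_notMem, card_image_of_injective _
    (s.injective.prodMap s.injective)]
  simp only [mem_image, mem_filter, mem_univ, true_and, Prod.exists, Prod.map_apply,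
    Prod.mk.injEq, not_exists, not_and]
  rintro a b ⟨h1, -⟩ ha hb
  rw [← hss a, ← hss b, ha, hb, hsi, hsj] at h1
  exact absurd h1 hlt.not_gt

theorem length_mul_swap_of_gt {i j : Fin n} (hij : (j : ℕ) = i + 1) {x : Equiv.Perm (Fin n)}
    (h : x j < x i) : length (x * Equiv.swap i j) + 1 = length x := by
  have := length_mul_swap_of_lt hij (x := x * Equiv.swap i j) (by simpa using h)
  rw [← this, mul_assoc, Equiv.swap_mul_self, mul_one]

theorem length_mul_swap_lt_iff {i j : Fin n} (hij : (j : ℕ) = i + 1) {x : Equiv.Perm (Fin n)} :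
    length (x * Equiv.swap i j) < length x ↔ x j < x i := by
  have hne : i ≠ j := by rw [Ne, Fin.ext_iff]; omega
  rcases lt_or_gt_of_ne (x.injective.ne hne) with h | h
  · have := length_mul_swap_of_lt hij h
    exact iff_of_false (by omega) h.not_gt
  · have := length_mul_swap_of_gt hij h
    exact iff_of_true (by omega) h

theorem lt_length_mul_swap_iff {i j : Fin n} (hij : (j : ℕ) = i + 1) {x : Equiv.Perm (Fin n)} :
    length x < length (x * Equiv.swap i j) ↔ x i < x j := by
  have hne : i ≠ j := by rw [Ne, Fin.ext_iff]; omega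
  rcases lt_or_gt_of_ne (x.injective.ne hne) with h | h
  · have := length_mul_swap_of_lt hij h
    exact iff_of_true (by omega) h
  · have := length_mul_swap_of_gt hij h
    exact iff_of_false (by omega) h.not_gt

/-- Induction on `j - i`: with `k = i + 1` and `s = swap i k`, one has `swap i j = s * swap k j *
s`. The middle factor lengthens by induction, the outer ones change the length by one each, and they
never both shorten, since `x k < x i` forces `x k < x j`. -/
theorem length_lt_mul_swap {i j : Fin n} (hij : i < j) {x : Equiv.Perm (Fin n)}
    (h : x i < x j) : length x < length (x * Equiv.swap i j) := by
  obtain ⟨d, hd⟩ : ∃ d : ℕ, (j : ℕ) = i + 1 + d := ⟨j - i - 1, by rw [Fin.lt_def] at hij; omega⟩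
  induction d generalizing i x with
  | zero => exact (lt_length_mul_swap_iff hd).2 h
  | succ d ih =>
    set k : Fin n := ⟨i + 1, by omega⟩ with hk
    have hik : (k : ℕ) = i + 1 := rfl
    have hij' : i ≠ j := hij.ne
    have hkj' : k ≠ j := by rw [Ne, Fin.ext_iff]; omega
    have hik' : i ≠ k := by rw [Ne, Fin.ext_iff]; omega
    set s := Equiv.swap i k with hs
    have hsk : s k = i := Equiv.swap_apply_right i k
    have hsi : s i = k := Equiv.swap_apply_left i k
    have hsj : s j = j := Equiv.swap_apply_of_ne_of_ne hij'.symm hkj'.symm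
    have heq : x * Equiv.swap i j = x * s * Equiv.swap k j * s := by
      have h1 := Equiv.mul_swap_eq_swap_mul s k j
      rw [hsk, hsj] at h1
      rw [mul_assoc x, h1, mul_assoc, mul_assoc, hs, Equiv.swap_mul_self, mul_one]
    have h1 : length (x * s) < length (x * s * Equiv.swap k j) :=
      ih (i := k) (by rw [Fin.lt_def]; omega) (by simpa [hsk, hsj] using h) (by omega)
    have hA : (x * s * Equiv.swap k j) i = x k := by
      simp [Equiv.swap_apply_of_ne_of_ne hik' hij', hsi]
    have hB : (x * s * Equiv.swap k j) k = x j := by simp [hsj]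
    rw [heq]
    rcases lt_or_gt_of_ne (x.injective.ne hik') with h2 | h2
    · have h3 := length_mul_swap_of_lt hik h2
      rcases lt_or_gt_of_ne (x.injective.ne hkj') with h4 | h4
      · have h5 := length_mul_swap_of_lt hik (x := x * s * Equiv.swap k j) (by rwa [hA, hB])
        rw [← hs] at h3 h5; omega
      · have h5 := length_mul_swap_of_gt hik (x := x * s * Equiv.swap k j) (by rwa [hA, hB])
        rw [← hs] at h3 h5; omega
    · have h3 := length_mul_swap_of_gt hik h2
      have h5 := length_mul_swap_of_lt hik (x := x * s * Equiv.swap k j)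
        (by rw [hA, hB]; exact h2.trans h)
      rw [← hs] at h3 h5; omega

theorem length_mul_swap_lt {i j : Fin n} (hij : i < j) {x : Equiv.Perm (Fin n)}
    (h : x j < x i) : length (x * Equiv.swap i j) < length x := by
  have := length_lt_mul_swap hij (x := x * Equiv.swap i j) (by simpa using h)
  rwa [mul_assoc, Equiv.swap_mul_self, mul_one] at this

theorem bruhatLE_mul_swap {i j : Fin n} {x : Equiv.Perm (Fin n)}
    (h : length x < length (x * Equiv.swap i j)) : BruhatLE x (x * Equiv.swap i j) := by
  refine Relation.ReflTransGen.single ⟨i, j, ?_, rfl, h⟩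
  rintro rfl
  exact h.ne (by rw [Equiv.swap_self]; exact congrArg length (mul_one x).symm)

/-- The smaller of `x` and `x * swap i j`. -/
def minSwap (i j : Fin n) (x : Equiv.Perm (Fin n)) : Equiv.Perm (Fin n) :=
  if x j < x i then x * Equiv.swap i j else x

theorem minSwap_mul_swap {i j : Fin n} (hij : i ≠ j) (x : Equiv.Perm (Fin n)) :
    minSwap i j (x * Equiv.swap i j) = minSwap i j x := by
  unfold minSwap
  have := x.injective.ne hij
  rcases lt_or_gt_of_ne this with h | h <;> simp [h, h.not_gt, mul_assoc]

theorem minSwap_le {i j : Fin n} (hij : (j : ℕ) = i + 1) (x : Equiv.Perm (Fin n)) :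
    BruhatLE (minSwap i j x) x := by
  unfold minSwap
  split_ifs with h
  · have h1 := (length_mul_swap_lt_iff hij).2 h
    have h2 := bruhatLE_mul_swap (x := x * Equiv.swap i j) (i := i) (j := j)
      (by rwa [mul_assoc, Equiv.swap_mul_self, mul_one])
    rwa [mul_assoc, Equiv.swap_mul_self, mul_one] at h2
  · exact Relation.ReflTransGen.refl

/-- A form of the lifting property, checked on a single reflection step. -/
theorem BruhatLE.min_swap {i j : Fin n} (hij : (j : ℕ) = i + 1) {x y : Equiv.Perm (Fin n)}
    (h : BruhatLE x y) : BruhatLE (minSwap i j x) (minSwap i j y) := by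
  refine Relation.ReflTransGen.lift' (minSwap i j) ?_ x y h
  clear h x y
  have hne : i ≠ j := by rw [Ne, Fin.ext_iff]; omega
  have main (x : Equiv.Perm (Fin n)) (a b : Fin n) (hab : a < b)
      (hl : length x < length (x * Equiv.swap a b)) :
      BruhatLE (minSwap i j x) (minSwap i j (x * Equiv.swap a b)) := by
    -- For this pair both elements have the same minimum. Any other pair keeps its order under `s`,
    -- so the step remains increasing after right multiplication by `s`.
    by_cases hab' : a = i ∧ b = j
    · rw [hab'.1, hab'.2, minSwap_mul_swap hne]
      exact Relation.ReflTransGen.refl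
    have hx : x a < x b := by
      by_contra hx
      exact hl.not_gt (length_mul_swap_lt hab
        (lt_of_le_of_ne (not_lt.1 hx) (x.injective.ne hab.ne')))
    have hs := swap_lt_swap hij hab hab'
    set s := Equiv.swap i j with hs'
    have heq : x * Equiv.swap a b * s = x * s * Equiv.swap (s a) (s b) := by
      have h1 := Equiv.mul_swap_eq_swap_mul s (s a) (s b)
      simp only [hs', Equiv.swap_apply_self] at h1
      rw [mul_assoc, mul_assoc, h1]
    have h2 : BruhatLE (x * s) (x * Equiv.swap a b * s) := by
      rw [heq]
      exact bruhatLE_mul_swap (length_lt_mul_swap hs (by simpa [hs'] using hx))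
    by_cases hy : (x * Equiv.swap a b) j < (x * Equiv.swap a b) i
    · have h3 : minSwap i j (x * Equiv.swap a b) = x * Equiv.swap a b * s :=
        if_pos hy
      rw [h3]
      refine Relation.ReflTransGen.trans ?_ h2
      rw [← minSwap_mul_swap hne]
      exact minSwap_le hij _
    · have h3 : minSwap i j (x * Equiv.swap a b) = x * Equiv.swap a b :=
        if_neg hy
      rw [h3]
      exact (minSwap_le hij x).trans (bruhatLE_mul_swap hl)
  rintro x y ⟨a, b, hab, rfl, hl⟩
  rcases lt_or_gt_of_ne hab with hab | hab
  · exact main x a b hab hl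
  · rw [Equiv.swap_comm] at hl ⊢
    exact main x b a hab hl

theorem BruhatLE.mul_swap_of_le_mul_swap {i j : Fin n} (hij : (j : ℕ) = i + 1)
    {x u : Equiv.Perm (Fin n)} (hx : x j < x i) (h : BruhatLE x (u * Equiv.swap i j)) :
    BruhatLE (x * Equiv.swap i j) u := by
  have hne : i ≠ j := by rw [Ne, Fin.ext_iff]; omega
  have h1 := BruhatLE.min_swap hij h
  rw [minSwap_mul_swap hne, minSwap, if_pos hx] at h1
  exact h1.trans (minSwap_le hij u)

theorem BruhatLE.mul_swap_of_le {i j : Fin n} (hij : (j : ℕ) = i + 1)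
    {x u : Equiv.Perm (Fin n)} (hx : x j < x i) (h : BruhatLE x u) :
    BruhatLE (x * Equiv.swap i j) u := by
  have h1 := minSwap_le hij x
  rw [minSwap, if_pos hx] at h1
  exact h1.trans h

theorem length_inv (w : Equiv.Perm (Fin n)) : length w⁻¹ = length w := by
  unfold length
  refine Finset.card_bij' (fun p _ => (w⁻¹ p.2, w⁻¹ p.1)) (fun p _ => (w p.2, w p.1)) ?_ ?_ ?_ ?_
  · rintro ⟨p, q⟩ h; simpa [and_comm] using h
  · rintro ⟨p, q⟩ h; simpa [and_comm] using h
  · rintro ⟨p, q⟩ h; simp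
  · rintro ⟨p, q⟩ h; simp

/-- The number of common inversions of two permutations. -/
def commonInversions (v σ : Equiv.Perm (Fin n)) : ℕ :=
  #{p : Fin n × Fin n | p.1 < p.2 ∧ v p.2 < v p.1 ∧ σ p.2 < σ p.1}

/-- Transported by `v`, the inversions of `w` correspond to the symmetric difference of the
inversion sets of `v` and `w * v`. -/
theorem two_mul_commonInversions (w v : Equiv.Perm (Fin n)) :
    2 * commonInversions v (w * v) + length w = length (w * v) + length v := by
  set σ := w * v with hσ
  have h1 : length w = #{p : Fin n × Fin n | v p.1 < v p.2 ∧ σ p.2 < σ p.1} := by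
    unfold length
    refine Finset.card_bij' (fun p _ => (v⁻¹ p.1, v⁻¹ p.2)) (fun p _ => (v p.1, v p.2)) ?_ ?_ ?_ ?_
    · rintro ⟨p, q⟩ h; simpa [hσ] using h
    · rintro ⟨p, q⟩ h; simpa [hσ] using h
    · rintro ⟨p, q⟩ h; simp
    · rintro ⟨p, q⟩ h; simp
  have h2 : #{p : Fin n × Fin n | (v p.1 < v p.2 ∧ σ p.2 < σ p.1) ∧ ¬ p.1 < p.2} =
      #{p : Fin n × Fin n | (p.1 < p.2 ∧ v p.2 < v p.1) ∧ ¬ σ p.2 < σ p.1} := by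
    refine Finset.card_bij' (fun p _ => p.swap) (fun p _ => p.swap) ?_ ?_ ?_ ?_
    · rintro ⟨p, q⟩ h
      simp only [mem_filter, mem_univ, true_and, Prod.fst_swap, Prod.snd_swap] at h ⊢
      have : p ≠ q := by rintro rfl; exact h.1.1.false
      exact ⟨⟨lt_of_le_of_ne (not_lt.1 h.2) this.symm, h.1.1⟩, h.1.2.not_gt⟩
    · rintro ⟨p, q⟩ h
      simp only [mem_filter, mem_univ, true_and, Prod.fst_swap, Prod.snd_swap] at h ⊢
      exact ⟨⟨h.1.2, lt_of_le_of_ne (not_lt.1 h.2) (σ.injective.ne h.1.1.ne)⟩, h.1.1.not_gt⟩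
    · simp
    · simp
  have h3 : #{p : Fin n × Fin n | (v p.1 < v p.2 ∧ σ p.2 < σ p.1) ∧ p.1 < p.2} =
      #{p : Fin n × Fin n | (p.1 < p.2 ∧ σ p.2 < σ p.1) ∧ ¬ v p.2 < v p.1} := by
    congr 1
    ext ⟨p, q⟩
    simp only [mem_filter, mem_univ, true_and]
    constructor
    · rintro ⟨⟨h1, h2⟩, h3⟩; exact ⟨⟨h3, h2⟩, h1.not_gt⟩
    · rintro ⟨⟨h1, h2⟩, h3⟩
      exact ⟨⟨lt_of_le_of_ne (not_lt.1 h3) (v.injective.ne h1.ne), h2⟩, h1⟩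
  have e1 := card_filter_add_card_filter_not
    (s := ({p : Fin n × Fin n | v p.1 < v p.2 ∧ σ p.2 < σ p.1} : Finset _)) (fun p => p.1 < p.2)
  have e2 := card_filter_add_card_filter_not
    (s := ({p : Fin n × Fin n | p.1 < p.2 ∧ σ p.2 < σ p.1} : Finset _)) (fun p => v p.2 < v p.1)
  have e3 := card_filter_add_card_filter_not
    (s := ({p : Fin n × Fin n | p.1 < p.2 ∧ v p.2 < v p.1} : Finset _)) (fun p => σ p.2 < σ p.1)
  have e4 : #{p : Fin n × Fin n | (p.1 < p.2 ∧ σ p.2 < σ p.1) ∧ v p.2 < v p.1} =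
      commonInversions v σ := by
    unfold commonInversions; congr 1; ext; simp; tauto
  have e5 : #{p : Fin n × Fin n | (p.1 < p.2 ∧ v p.2 < v p.1) ∧ σ p.2 < σ p.1} =
      commonInversions v σ := by
    unfold commonInversions; congr 1; ext; simp; tauto
  rw [filter_filter, filter_filter] at e1 e2 e3
  have e6 : length σ = #{p : Fin n × Fin n | p.1 < p.2 ∧ σ p.2 < σ p.1} := rfl
  have e7 : length v = #{p : Fin n × Fin n | p.1 < p.2 ∧ v p.2 < v p.1} := rfl
  omega

/-- Downward induction along the right weak order, from the long element. -/
theorem longElement_induction {P : Equiv.Perm (Fin n) → Prop} (base : P (longElement n))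
    (step : ∀ (x : Equiv.Perm (Fin n)) (i j : Fin n), (j : ℕ) = i + 1 → x j < x i → P x →
      P (x * Equiv.swap i j)) (x : Equiv.Perm (Fin n)) : P x := by
  -- The number of all pairs is a crude bound for the length; it only serves to make the induction
  -- terminate.
  obtain ⟨d, hd⟩ : ∃ d, d = n * n - length x := ⟨_, rfl⟩
  induction d using Nat.strong_induction_on generalizing x with
  | _ d ih =>
    by_cases h : ∃ i j : Fin n, (j : ℕ) = i + 1 ∧ x i < x j
    · obtain ⟨i, j, hij, hx⟩ := h
      have h1 := length_mul_swap_of_lt hij hx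
      have h2 : length (x * Equiv.swap i j) ≤ n * n := by
        unfold length
        exact (card_le_univ _).trans (by simp)
      have h3 := step (x * Equiv.swap i j) i j hij (by simpa using hx)
        (ih _ (by omega) _ rfl)
      rwa [mul_assoc, Equiv.swap_mul_self, mul_one] at h3
    · push Not at h
      -- A permutation without ascents is decreasing, and reversing its values gives an order
      -- automorphism of `Fin n`, necessarily the identity.
      have hanti : StrictAnti x := by
        have : ∀ (d : ℕ) (i j : Fin n), (j : ℕ) = i + 1 + d → x j < x i := by
          intro d
          induction d with
          | zero =>
            intro i j hij
            refine lt_of_le_of_ne (h i j hij) (x.injective.ne ?_)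
            rw [Ne, Fin.ext_iff]; omega
          | succ d ih =>
            intro i j hij
            have h1 := ih i ⟨i + 1 + d, by omega⟩ rfl
            refine lt_trans (lt_of_le_of_ne (h ⟨i + 1 + d, by omega⟩ j (by simp; omega))
              (x.injective.ne ?_)) h1
            rw [Ne, Fin.ext_iff]; simp; omega
        intro i j hij
        exact this (j - i - 1) i j (by rw [Fin.lt_def] at hij; omega)
      have hx : x = longElement n := by
        have hmono : StrictMono (fun i => (x i).rev) := fun i j hij => by
          simpa using hanti hij
        have := Subsingleton.elim (hmono.orderIsoOfSurjective _
          (Fin.rev_surjective.comp x.surjective)) (OrderIso.refl (Fin n))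
        ext i
        have h2 := congrArg (fun f : Fin n ≃o Fin n => f i) this
        have h3 : (x i).rev = i := h2
        have h4 : x i = i.rev := by rw [← Fin.rev_rev (x i), h3]
        rw [h4]; rfl
      rw [hx]; exact base

end ColoredLattice

/-! ### The base case: a single state. -/

namespace ColoredLattice
open Finset
variable {n : ℕ}

theorem mem_posRoots {α : Fin n × Fin n} : α ∈ posRoots n ↔ α.1 < α.2 := by
  unfold posRoots; exact mem_filter_univ _

theorem posRoots_eq : posRoots n = ({α | α.1 < α.2} : Finset (Fin n × Fin n)) := by
  ext α; rw [mem_posRoots, mem_filter_univ]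

theorem topBoundary_squarePartition (σ : Equiv.Perm (Fin n)) (j : Fin n) :
    topBoundary σ (squarePartition n) j = {σ j} := by
  unfold topBoundary squarePartition
  have : ({i | Fin.rev i = j} : Finset (Fin n)) = {j.rev} := by
    ext i; simp [Fin.rev_eq_iff]
  rw [this, image_singleton, Fin.rev_rev]

/-- The unique admissible state for the right boundary `σ * longElement n`. -/
def baseState (σ : Equiv.Perm (Fin n)) : DecoratedLattice n n n :=
  (fun k j => if (j : ℕ) + k < n then {σ j} else ∅,
    fun i l => if (l : ℕ) + i < n then some (σ i.rev) else none)

/-- The state is forced row by row from the top: the color of column `j` descends to row `j.rev`,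
turns, and runs straight to the right edge. -/
theorem isAdmissibleState_iff_eq_baseState (σ : Equiv.Perm (Fin n))
    (s : DecoratedLattice n n n) :
    IsAdmissibleState (topBoundary σ (squarePartition n))
      (rightBoundary (σ * longElement n)) s ↔ s = baseState σ := by
  have hright (i : Fin n) : rightBoundary (σ * longElement n) i = some (σ i.rev) := rfl
  constructor
  · rintro ⟨h1, -, h3, h4, h5⟩
    have hrow (i : Fin n) (hv : ∀ j, s.1 i.castSucc j = (baseState σ).1 i.castSucc j) :
        ∀ l, s.2 i l = (baseState σ).2 i l := by
      -- Read from the right edge: a column `l` before `i.rev` carries a color other than `σ i.rev`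
      -- on top, so `σ i.rev` on the right of the vertex must also be on its left.
      have hA : ∀ (l : ℕ) (hl : l + i < n), s.2 i ⟨l, by omega⟩ = some (σ i.rev) := by
        intro l
        induction l with
        | zero => intro _; exact (h3 i).trans (hright i)
        | succ l ih =>
          intro hl
          have hne : σ ⟨l, by omega⟩ ≠ σ i.rev := σ.injective.ne (by
            rw [Ne, Fin.ext_iff, Fin.val_rev]; simp only; omega)
          have h6 := h5 i ⟨l, by omega⟩
          rw [hv] at h6
          have h7 := ih (by omega)
          simp only [Fin.castSucc_mk, Fin.succ_mk, h7] at h6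
          have h8 : (baseState σ).1 i.castSucc ⟨l, by omega⟩ = {σ ⟨l, by omega⟩} :=
            if_pos (by simp only [Fin.val_castSucc]; omega)
          rw [h8] at h6
          revert h6
          generalize s.2 i ⟨l + 1, by omega⟩ = a
          intro h6
          match a, h6 with
          | none, h6 => exact absurd (mem_singleton.1 h6.1).symm hne
          | some c, h6 =>
            rcases h6 with h6 | h6
            · rw [h6.1]
            · exact absurd (mem_singleton.1 h6.2.2.1).symm hne
      -- Read from the left edge: from column `i.rev + 1` on the top edges are empty, so an
      -- uncolored left edge forces an uncolored right edge.
      have hB : ∀ (d l : ℕ) (hd : l + d = n) (hl : n ≤ l + i),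
          s.2 i ⟨l, by omega⟩ = none := by
        intro d
        induction d with
        | zero =>
          intro l hd hl
          obtain rfl : l = n := by omega
          exact h4 i
        | succ d ih =>
          intro l hd hl
          have h6 := h5 i ⟨l, by omega⟩
          rw [hv] at h6
          have h7 := ih (l + 1) (by omega) (by omega)
          simp only [Fin.castSucc_mk, Fin.succ_mk, h7] at h6
          have h8 : (baseState σ).1 i.castSucc ⟨l, by omega⟩ = ∅ :=
            if_neg (by simp only [Fin.val_castSucc]; omega)
          rw [h8] at h6
          revert h6
          generalize s.2 i ⟨l, by omega⟩ = b
          intro h6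
          match b, h6 with
          | none, _ => rfl
          | some c, h6 => exact absurd h6.1 (notMem_empty c)
      intro l
      by_cases hl : (l : ℕ) + i < n
      · exact (hA l hl).trans (if_pos hl).symm
      · exact (hB (n - l) l (by omega) (by omega)).trans (if_neg hl).symm
    have hcol : ∀ (k : ℕ) (hk : k < n + 1) (j : Fin n), s.1 ⟨k, hk⟩ j = (baseState σ).1 ⟨k, hk⟩ j := by
      intro k
      induction k with
      | zero =>
        intro hk j
        refine ((h1 j).trans (topBoundary_squarePartition σ j)).trans (if_pos ?_).symm
        simp
      | succ k ih =>
        intro hk j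
        have hv := ih (by omega)
        have hr := hrow ⟨k, by omega⟩ hv
        have h6 := h5 ⟨k, by omega⟩ j
        rw [hr, hr] at h6
        have h9 := hv j
        simp only [Fin.castSucc_mk, Fin.succ_mk, h9] at h6
        have hT : ∀ T, VertexAdmissible ((baseState σ).2 ⟨k, by omega⟩ j.succ)
            ((baseState σ).1 ⟨k, by omega⟩ j) ((baseState σ).2 ⟨k, by omega⟩ j.castSucc) T →
            T = (baseState σ).1 ⟨k + 1, hk⟩ j := by
          intro T
          simp only [baseState, Fin.val_succ, Fin.val_castSucc]
          rcases lt_trichotomy ((j : ℕ) + k + 1) n with h | h | h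
          · rw [if_pos (by omega), if_pos (by omega), if_pos (by omega), if_pos (by omega)]
            rintro (h | h)
            · exact h.2
            · exact absurd rfl h.1
          · rw [if_neg (by omega), if_pos (by omega), if_pos (by omega), if_neg (by omega)]
            rintro ⟨h, rfl⟩
            rw [mem_singleton] at h
            rw [h, erase_singleton]
          · rw [if_neg (by omega), if_neg (by omega), if_neg (by omega), if_neg (by omega)]
            exact id
        exact hT _ h6
    refine Prod.ext ?_ ?_
    · funext k j; exact hcol k k.2 j
    · funext i l; exact hrow i (hcol i _) l
  · rintro rfl
    refine ⟨fun j => ?_, fun j => ?_, fun i => ?_, fun i => ?_, fun i j => ?_⟩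
    · rw [topBoundary_squarePartition]; exact if_pos (by simp)
    · exact if_neg (by simp)
    · exact if_pos (by simp)
    · exact if_neg (by simp)
    · simp only [baseState, Fin.val_succ, Fin.val_castSucc]
      rcases lt_trichotomy ((j : ℕ) + i + 1) n with h | h | h
      · rw [if_pos (by omega), if_pos (by omega), if_pos (by omega), if_pos (by omega)]
        exact .inl ⟨rfl, rfl⟩
      · rw [if_neg (by omega), if_pos (by omega), if_pos (by omega), if_neg (by omega)]
        have : j = i.rev := by rw [Fin.ext_iff, Fin.val_rev]; omega
        rw [← this]
        exact ⟨mem_singleton_self _, by simp⟩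
      · rw [if_neg (by omega), if_neg (by omega), if_neg (by omega), if_neg (by omega)]
        rfl

/-- A root `(p, q)` corresponds to the crossing in row `q.rev` and column `p`, where `σ q` passes `σ
p`. Besides `1 - z`, it contributes `t` exactly when `(p, q)` is an inversion of `σ`. -/
theorem partitionFunction_base {K : Type*} [CommRing K] (t : K) (z : Fin n → Fin n → K)
    (σ : Equiv.Perm (Fin n)) :
    partitionFunction t z (topBoundary σ (squarePartition n))
      (rightBoundary (σ * longElement n)) =
    t ^ length σ * ∏ α ∈ posRoots n, (1 - z α.2.rev α.1) := by
  unfold partitionFunction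
  simp only [isAdmissibleState_iff_eq_baseState]
  rw [Finset.filter_eq', if_pos (mem_univ _), Finset.sum_singleton]
  have hw (i j : Fin n) : vertexWeight t (z i j) ((baseState σ).2 i j.succ)
      ((baseState σ).1 i.castSucc j) ((baseState σ).2 i j.castSucc) =
      if j < i.rev then (if σ i.rev < σ j then t else 1) * (1 - z i j) else 1 := by
    simp only [baseState, Fin.val_succ, Fin.val_castSucc, Fin.lt_def (a := j), Fin.val_rev]
    rcases lt_trichotomy ((j : ℕ) + i + 1) n with h | h | h
    · have hne : σ i.rev ≠ σ j := σ.injective.ne (by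
        rw [Ne, Fin.ext_iff, Fin.val_rev]; omega)
      rw [if_pos (by omega), if_pos (by omega), if_pos (by omega), if_pos (by omega)]
      simp only [vertexWeight, if_true, mem_singleton, hne, if_false, pow_zero, numAbove,
        filter_singleton]
      split_ifs <;> simp <;> ring
    · rw [if_neg (by omega), if_pos (by omega), if_pos (by omega), if_neg (by omega)]
      have : j = i.rev := by rw [Fin.ext_iff, Fin.val_rev]; omega
      simp [vertexWeight, this, numAbove, numBelow, filter_singleton]
    · rw [if_neg (by omega), if_neg (by omega), if_neg (by omega), if_neg (by omega)]
      simp [vertexWeight]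
  unfold stateWeight
  simp only [hw]
  rw [← Equiv.prod_comp Fin.revPerm, Finset.prod_comm]
  simp only [Fin.revPerm_apply, Fin.rev_rev]
  have hlen : length σ = #{α ∈ posRoots n | σ α.2 < σ α.1} := by
    unfold length; rw [posRoots_eq, filter_filter]
  rw [hlen, ← prod_ite_pow, ← Finset.prod_mul_distrib]
  rw [posRoots_eq, Finset.prod_filter, Fintype.prod_prod_type]

/-! ### Restriction to `x i = y (u i)`: recursion, vanishing and diagonal values. -/

section Restriction

theorem tVar_ne_zero : tVar n ≠ 0 := by
  unfold tVar
  rw [Ne, FaithfulSMul.algebraMap_eq_zero_iff]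
  exact MvPolynomial.X_ne_zero _

theorem yVar_ne_zero (j : Fin n) : yVar j ≠ 0 := by
  unfold yVar
  rw [Ne, FaithfulSMul.algebraMap_eq_zero_iff]
  exact MvPolynomial.X_ne_zero _

theorem yVar_injective : Function.Injective (yVar (n := n)) := fun i j h =>
  Option.some_injective _ (MvPolynomial.X_injective (FaithfulSMul.algebraMap_injective _ _ h))

theorem map_vertexWeight {R R' : Type*} [CommRing R] [CommRing R'] (f : R →+* R') {r : ℕ} (t z : R)
    (a : Option (Fin r)) (S : Finset (Fin r)) (b : Option (Fin r)) :
    f (vertexWeight t z a S b) = vertexWeight (f t) (f z) a S b := by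
  match a, b with
  | none, none => simp [vertexWeight]
  | none, some c => simp [vertexWeight]
  | some c, none => simp [vertexWeight]
  | some c, some d => simp only [vertexWeight]; split_ifs <;> simp

theorem map_partitionFunction {R R' : Type*} [CommRing R] [CommRing R'] (f : R →+* R') {m N r : ℕ}
    (t : R) (z : Fin m → Fin N → R) (top : Fin N → Finset (Fin r))
    (right : Fin m → Option (Fin r)) :
    f (partitionFunction t z top right) =
      partitionFunction (f t) (fun i j => f (z i j)) top right := by
  simp only [partitionFunction, stateWeight, map_sum, map_prod, map_vertexWeight]

theorem restrict_ZSquare (σ w u : Equiv.Perm (Fin n)) :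
    restrict (ZSquare σ w) u = partitionFunction (tVar n)
      (fun i j => yVar (u i) * (yVar j)⁻¹) (topBoundary σ (squarePartition n))
      (rightBoundary w) := by
  unfold restrict ZSquare
  rw [map_partitionFunction]
  simp

theorem one_sub_yPow_ne_zero {i j : Fin n} (h : i ≠ j) : 1 - yPow (i, j) ≠ 0 := by
  rw [sub_ne_zero, yPow, Ne, eq_comm, div_eq_one_iff_eq (yVar_ne_zero _)]
  exact yVar_injective.ne h

theorem restrict_ZSquare_exchange (σ w u : Equiv.Perm (Fin n)) {i j : Fin n}
    (hij : (j : ℕ) = i + 1) :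
    rDiag (tVar n) (yVar (u i)) (yVar (u j)) (some (w i)) (some (w j)) * restrict (ZSquare σ w) u +
      rSwap (tVar n) (yVar (u i)) (yVar (u j)) (some (w i)) (some (w j)) *
        restrict (ZSquare σ (w * Equiv.swap i j)) u =
    (yVar (u i) - tVar n * yVar (u j)) * restrict (ZSquare σ w) (u * Equiv.swap i j) := by
  simp only [restrict_ZSquare]
  exact partitionFunction_exchange (mul_inv_cancel₀ tVar_ne_zero)
    (fun j => (inv_ne_zero (yVar_ne_zero j)).isUnit) (fun i => yVar (u i))
    (topBoundary σ (squarePartition n)) (rightBoundary w) hij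

theorem restrict_ZSquare_mul_swap_of_gt (σ w u : Equiv.Perm (Fin n)) {i j : Fin n}
    (hij : (j : ℕ) = i + 1) (h : w j < w i) :
    restrict (ZSquare σ (w * Equiv.swap i j)) u =
      (tVar n - 1) / (1 - yPow (rootAct u (i, j))) * restrict (ZSquare σ w) u +
      (yPow (rootAct u (i, j)) - tVar n) / (1 - yPow (rootAct u (i, j))) *
        restrict (ZSquare σ w) (u * Equiv.swap i j) := by
  have h1 := restrict_ZSquare_exchange σ w u hij
  have hne : i ≠ j := by rw [Ne, Fin.ext_iff]; omega
  simp only [rDiag, rSwap, h.ne', h.not_gt, if_false] at h1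
  have h2 := one_sub_yPow_ne_zero (u.injective.ne hne)
  have h3 := yVar_ne_zero (u j)
  simp only [rootAct, yPow] at *
  have h4 : yVar (u j) - yVar (u i) ≠ 0 := sub_ne_zero.2 (yVar_injective.ne (u.injective.ne hne.symm))
  field_simp
  linear_combination h1

theorem restrict_ZSquare_mul_swap_of_lt (σ w u : Equiv.Perm (Fin n)) {i j : Fin n}
    (hij : (j : ℕ) = i + 1) (h : w i < w j) :
    restrict (ZSquare σ (w * Equiv.swap i j)) u =
      (tVar n - 1) * yPow (rootAct u (i, j)) / (tVar n * (1 - yPow (rootAct u (i, j)))) *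
        restrict (ZSquare σ w) u +
      (yPow (rootAct u (i, j)) - tVar n) / (tVar n * (1 - yPow (rootAct u (i, j)))) *
        restrict (ZSquare σ w) (u * Equiv.swap i j) := by
  have h1 := restrict_ZSquare_exchange σ w u hij
  have hne : i ≠ j := by rw [Ne, Fin.ext_iff]; omega
  simp only [rDiag, rSwap, h.ne, h, if_false, if_true] at h1
  have h2 := one_sub_yPow_ne_zero (u.injective.ne hne)
  have h3 := yVar_ne_zero (u j)
  have h5 := tVar_ne_zero (n := n)
  simp only [rootAct, yPow] at *
  have h4 : yVar (u j) - yVar (u i) ≠ 0 := sub_ne_zero.2 (yVar_injective.ne (u.injective.ne hne.symm))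
  field_simp
  linear_combination h1

theorem restrict_ZSquare_base (σ u : Equiv.Perm (Fin n)) :
    restrict (ZSquare σ (σ * longElement n)) u =
      tVar n ^ length σ * ∏ α ∈ posRoots n, (1 - yVar (u α.2.rev) * (yVar α.1)⁻¹) := by
  rw [restrict_ZSquare, partitionFunction_base]

theorem restrict_ZSquare_base_longElement (σ : Equiv.Perm (Fin n)) :
    restrict (ZSquare σ (σ * longElement n)) (longElement n) =
      tVar n ^ length σ * ∏ α ∈ posRoots n, (1 - (yPow α)⁻¹) := by
  rw [restrict_ZSquare_base]
  congr 1
  refine Finset.prod_congr rfl fun α _ => ?_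
  simp [longElement, yPow, div_eq_mul_inv, mul_comm]

/-- The factor for `(p, q)` vanishes when `u q.rev = p`. If none does, `u * longElement n` moves no
index down, hence is the identity. -/
theorem restrict_ZSquare_base_ne_zero_iff (σ u : Equiv.Perm (Fin n)) :
    restrict (ZSquare σ (σ * longElement n)) u ≠ 0 ↔ u = longElement n := by
  constructor
  · intro h
    rw [restrict_ZSquare_base] at h
    have h1 := Finset.prod_ne_zero_iff.1 (right_ne_zero_of_mul h)
    have h2 (q : Fin n) : q ≤ (u * longElement n) q := by
      by_contra hq
      have h3 := h1 (u q.rev, q) (mem_posRoots.2 (not_le.1 hq))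
      exact h3 (by simp [yVar_ne_zero])
    -- A permutation preserves the sum of all indices, so the termwise inequalities are equalities.
    have h3 : ∑ q : Fin n, (q : ℕ) = ∑ q, ((u * longElement n) q : ℕ) :=
      ((u * longElement n).sum_comp univ (fun q : Fin n => (q : ℕ)) (by simp)).symm
    have h4 := (Finset.sum_eq_sum_iff_of_le (fun q _ => Fin.le_def.1 (h2 q))).1 h3
    ext q
    have h5 := h4 q.rev (mem_univ _)
    simp only [longElement, Equiv.Perm.mul_apply, Fin.revPerm_apply, Fin.rev_rev] at h5 ⊢
    exact h5.symm
  · rintro rfl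
    rw [restrict_ZSquare_base_longElement]
    refine mul_ne_zero (pow_ne_zero _ tVar_ne_zero) (Finset.prod_ne_zero_iff.2 fun α hα => ?_)
    have hα' : α.1 ≠ α.2 := by
      have : α.1 < α.2 := mem_posRoots.1 hα
      exact this.ne
    rw [yPow, inv_div]
    exact one_sub_yPow_ne_zero hα'.symm

/-- If the shorter element `x * swap i j` is not below `u`, then `x` is below neither `u` nor `u *
swap i j`, so both terms of the recursion vanish. -/
theorem restrict_ZSquare_eq_zero (σ x u : Equiv.Perm (Fin n)) (h : ¬ BruhatLE x u) :
    restrict (ZSquare σ (σ * x)) u = 0 := by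
  revert u
  refine longElement_induction (P := fun x => ∀ u, ¬ BruhatLE x u →
    restrict (ZSquare σ (σ * x)) u = 0) ?_ ?_ x
  · intro u hu
    by_contra h
    rw [← Ne, restrict_ZSquare_base_ne_zero_iff] at h
    exact hu (h ▸ Relation.ReflTransGen.refl)
  · intro x i j hij hx ih u hu
    have h1 := ih u fun h => hu (h.mul_swap_of_le hij hx)
    have h2 := ih (u * Equiv.swap i j) fun h => hu (h.mul_swap_of_le_mul_swap hij hx)
    have hne : i ≠ j := by rw [Ne, Fin.ext_iff]; omega
    rw [← mul_assoc]
    rcases lt_or_gt_of_ne ((σ * x).injective.ne hne) with h | h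
    · rw [restrict_ZSquare_mul_swap_of_lt σ _ u hij h, h1, h2, mul_zero, mul_zero, add_zero]
    · rw [restrict_ZSquare_mul_swap_of_gt σ _ u hij h, h1, h2, mul_zero, mul_zero, add_zero]

/-- The product over the positive roots in the diagonal values. -/
noncomputable def diagonalProd (v : Equiv.Perm (Fin n)) : RatField n :=
  ∏ α ∈ posRoots n, if v α.1 < v α.2 then 1 - tVar n * (yPow α)⁻¹ else 1 - (yPow α)⁻¹

theorem diagonalProd_eq (v : Equiv.Perm (Fin n)) : diagonalProd v =
    (∏ α ∈ posRoots n with IsPosRoot (rootAct v α), (1 - tVar n * (yPow α)⁻¹)) *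
      ∏ α ∈ posRoots n with IsNegRoot (rootAct v α), (1 - (yPow α)⁻¹) := by
  unfold diagonalProd
  rw [Finset.prod_ite]
  congr 1
  refine Finset.prod_congr (Finset.filter_congr fun α hα => ?_) fun _ _ => rfl
  have hα' : α.1 < α.2 := mem_posRoots.1 hα
  unfold IsNegRoot rootAct
  exact ⟨fun h => lt_of_le_of_ne (not_lt.1 h) (v.injective.ne hα'.ne'), fun h => h.not_gt⟩

/-- Passing from `x⁻¹` to `(x * swap i j)⁻¹` changes the sign of the image of only one positive
root, `(x j, x i)`, which goes from negative to positive. -/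
theorem diagonalProd_swap_mul {i j : Fin n} (hij : (j : ℕ) = i + 1) {x : Equiv.Perm (Fin n)}
    (hx : x j < x i) :
    (1 - (yPow (x j, x i))⁻¹) * diagonalProd (x * Equiv.swap i j)⁻¹ =
      (1 - tVar n * (yPow (x j, x i))⁻¹) * diagonalProd x⁻¹ := by
  have hlt : i < j := by rw [Fin.lt_def]; omega
  have hmem : (x j, x i) ∈ posRoots n := mem_posRoots.2 hx
  unfold diagonalProd
  rw [← Finset.mul_prod_erase _ _ hmem, ← Finset.mul_prod_erase _ _ hmem]
  have hprod : ∀ α ∈ (posRoots n).erase (x j, x i),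
      ((x * Equiv.swap i j)⁻¹ α.1 < (x * Equiv.swap i j)⁻¹ α.2 ↔ x⁻¹ α.1 < x⁻¹ α.2) := by
    rintro ⟨p, q⟩ h
    obtain ⟨h1, h2⟩ := mem_erase.1 h
    have h3 : p < q := mem_posRoots.1 h2
    obtain ⟨p, rfl⟩ := x.surjective p
    obtain ⟨q, rfl⟩ := x.surjective q
    have hpq : p ≠ q := fun h => h3.ne (congrArg x h)
    have inv_app (a : Fin n) : x⁻¹ (x a) = a := x.symm_apply_apply a
    simp only [mul_inv_rev, Equiv.swap_inv, Equiv.Perm.mul_apply, inv_app]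
    rcases lt_or_gt_of_ne hpq with h | h
    · refine iff_of_true (swap_lt_swap hij h ?_) h
      rintro ⟨rfl, rfl⟩
      exact h3.not_gt hx
    · refine iff_of_false (swap_lt_swap hij h ?_).not_gt h.not_gt
      rintro ⟨rfl, rfl⟩
      exact h1 rfl
  have h1 : (x * Equiv.swap i j)⁻¹ (x j) < (x * Equiv.swap i j)⁻¹ (x i) := by simpa using hlt
  have h2 : ¬ x⁻¹ (x j) < x⁻¹ (x i) := by simpa using hlt.le
  simp only [h1, h2, if_true, if_false]
  rw [Finset.prod_congr rfl fun α hα => if_congr (hprod α hα) rfl rfl]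
  ring

/-- Downward induction: the recursion at `x * s` involves the restrictions of the function for `x`
at `x * s` and at `x`. The former vanishes, and the latter is known. -/
theorem restrict_ZSquare_diagonal (σ x : Equiv.Perm (Fin n)) :
    restrict (ZSquare σ (σ * x)) x =
      tVar n ^ commonInversions x⁻¹ σ * (-1) ^ length (x⁻¹ * longElement n) *
        diagonalProd x⁻¹ := by
  refine longElement_induction (P := fun x => restrict (ZSquare σ (σ * x)) x =
      tVar n ^ commonInversions x⁻¹ σ * (-1) ^ length (x⁻¹ * longElement n) *
        diagonalProd x⁻¹) ?_ ?_ x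
  · rw [restrict_ZSquare_base_longElement]
    have hinv : (longElement n)⁻¹ = longElement n := rfl
    have h1 : longElement n * longElement n = 1 := by
      ext i; simp [longElement]
    have h2 : length (1 : Equiv.Perm (Fin n)) = 0 := by
      simp only [length, card_eq_zero, filter_eq_empty_iff]
      rintro ⟨p, q⟩ - ⟨h, h'⟩
      exact h.not_gt h'
    have h3 : commonInversions (longElement n) σ = length σ := by
      unfold commonInversions length
      congr 1
      ext ⟨p, q⟩
      simp [longElement]
    rw [hinv, h1, h2, h3, pow_zero, mul_one]
    congr 1
    refine Finset.prod_congr rfl fun α hα => ?_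
    have hα' : α.1 < α.2 := mem_posRoots.1 hα
    rw [if_neg]
    simpa [longElement] using hα'.le
  · clear x
    intro x i j hij hx ih
    have hne : i ≠ j := by rw [Ne, Fin.ext_iff]; omega
    set s := Equiv.swap i j with hs
    have hxs := length_mul_swap_of_gt hij hx
    rw [← hs] at hxs
    have hss : x * s * s = x := by rw [mul_assoc, hs, Equiv.swap_mul_self, mul_one]
    -- Bruhat order is compatible with length, so `x` is not below the shorter `x * s`.
    have hzero : restrict (ZSquare σ (σ * x)) (x * s) = 0 := by
      refine restrict_ZSquare_eq_zero σ x _ fun h => ?_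
      have : ∀ {a b : Equiv.Perm (Fin n)}, BruhatLE a b → length a ≤ length b := by
        intro a b hab
        induction hab with
        | refl => exact le_rfl
        | tail _ h ih => obtain ⟨_, _, _, _, h⟩ := h; exact ih.trans h.le
      have := this h
      omega
    have hroot : rootAct (x * s) (i, j) = (x j, x i) := by simp [rootAct, hs]
    have hy : 1 - yPow (x j, x i) ≠ 0 := one_sub_yPow_ne_zero hx.ne
    have hy0 : yPow (x j, x i) ≠ 0 := div_ne_zero (yVar_ne_zero _) (yVar_ne_zero _)
    have hprod := diagonalProd_swap_mul hij hx
    rw [← hs] at hprod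
    have hsign : length ((x * s)⁻¹ * longElement n) = length (x⁻¹ * longElement n) + 1 := by
      rw [← length_inv, ← length_inv (x⁻¹ * _)]
      simp only [mul_inv_rev, inv_inv]
      rw [← mul_assoc]
      refine length_mul_swap_of_lt hij ?_
      simpa [longElement] using hx
    -- As `length x` drops by one, the exponent of `t` drops by one if `length (σ * x)` rises and
    -- stays otherwise. This matches the extra `1 / t` in the second case of the recursion.
    have hk := two_mul_commonInversions (σ * x) x⁻¹
    have hk' := two_mul_commonInversions (σ * x * s) (x * s)⁻¹
    rw [mul_inv_cancel_right, length_inv] at hk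
    rw [mul_assoc σ x s, mul_inv_cancel_right, length_inv, ← mul_assoc] at hk'
    rw [← mul_assoc, hsign, pow_succ]
    have ht := tVar_ne_zero (n := n)
    generalize diagonalProd (x * s)⁻¹ = D' at *
    generalize diagonalProd x⁻¹ = D at *
    have hD : D' = (yPow (x j, x i) - tVar n) / (yPow (x j, x i) - 1) * D := by
      have : yPow (x j, x i) - 1 ≠ 0 := by rwa [← neg_sub, neg_ne_zero]
      field_simp at hprod ⊢
      linear_combination hprod
    have hneg : yPow (x j, x i) - 1 = -(1 - yPow (x j, x i)) := by ring
    rcases lt_or_gt_of_ne ((σ * x).injective.ne hne) with h | h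
    · have h1 := length_mul_swap_of_lt hij h
      have hkk : commonInversions x⁻¹ σ = commonInversions (x * s)⁻¹ σ + 1 := by
        rw [← hs] at h1; omega
      rw [restrict_ZSquare_mul_swap_of_lt σ _ _ hij h, ← hs, hss, hzero, ih, hroot, hD, hkk, hneg]
      field_simp
      ring
    · have h1 := length_mul_swap_of_gt hij h
      have hkk : commonInversions x⁻¹ σ = commonInversions (x * s)⁻¹ σ := by
        rw [← hs] at h1; omega
      rw [restrict_ZSquare_mul_swap_of_gt σ _ _ hij h, ← hs, hss, hzero, ih, hroot, hD, hkk, hneg]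
      field_simp
      ring

end Restriction

end ColoredLattice

open ColoredLattice in
theorem mainTheorem11 (n : ℕ) :
    -- the base case of the recursion
    (∀ σ u : Equiv.Perm (Fin n),
      (restrict (ZSquare σ (σ * longElement n)) u ≠ 0 ↔ u = longElement n) ∧
      restrict (ZSquare σ (σ * longElement n)) (longElement n) =
        tVar n ^ length σ * ∏ α ∈ posRoots n, (1 - (yPow α)⁻¹)) ∧
    -- the recursion; `(i, j)` is a simple root and `swap i j` its simple reflection
    (∀ (σ w u : Equiv.Perm (Fin n)) (i j : Fin n), (j : ℕ) = (i : ℕ) + 1 →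
      (length (w * Equiv.swap i j) < length w →
        restrict (ZSquare σ (w * Equiv.swap i j)) u =
          (tVar n - 1) / (1 - yPow (rootAct u (i, j))) * restrict (ZSquare σ w) u +
          (yPow (rootAct u (i, j)) - tVar n) / (1 - yPow (rootAct u (i, j))) *
            restrict (ZSquare σ w) (u * Equiv.swap i j)) ∧
      (length w < length (w * Equiv.swap i j) →
        restrict (ZSquare σ (w * Equiv.swap i j)) u =
          (tVar n - 1) * yPow (rootAct u (i, j)) / (tVar n * (1 - yPow (rootAct u (i, j)))) *
            restrict (ZSquare σ w) u +
          (yPow (rootAct u (i, j)) - tVar n) / (tVar n * (1 - yPow (rootAct u (i, j)))) *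
            restrict (ZSquare σ w) (u * Equiv.swap i j))) ∧
    -- vanishing
    (∀ σ w u : Equiv.Perm (Fin n), ¬ BruhatLE (σ⁻¹ * w) u → restrict (ZSquare σ w) u = 0) ∧
    -- the diagonal values; `k` is `(ℓ(σ) - ℓ(w) + ℓ(w⁻¹σ)) / 2`
    (∀ σ w : Equiv.Perm (Fin n), ∃ k : ℕ,
      2 * (k : ℤ) = (length σ : ℤ) - length w + length (w⁻¹ * σ) ∧
      restrict (ZSquare σ w) (σ⁻¹ * w) =
        tVar n ^ k * (-1) ^ length (w⁻¹ * σ * longElement n) *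
        (∏ α ∈ posRoots n with IsPosRoot (rootAct (w⁻¹ * σ) α), (1 - tVar n * (yPow α)⁻¹)) *
        ∏ α ∈ posRoots n with IsNegRoot (rootAct (w⁻¹ * σ) α), (1 - (yPow α)⁻¹)) := by
  
  refine ⟨fun σ u => ⟨restrict_ZSquare_base_ne_zero_iff σ u, restrict_ZSquare_base_longElement σ⟩,
    fun σ w u i j hij => ⟨fun h => ?_, fun h => ?_⟩, fun σ w u h => ?_, fun σ w => ?_⟩
  · exact restrict_ZSquare_mul_swap_of_gt σ w u hij ((length_mul_swap_lt_iff hij).1 h)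
  · exact restrict_ZSquare_mul_swap_of_lt σ w u hij ((lt_length_mul_swap_iff hij).1 h)
  · simpa using restrict_ZSquare_eq_zero σ (σ⁻¹ * w) u h
  -- The half-integer expression counts the common inversions of `w⁻¹ * σ` and `σ = w * (w⁻¹ * σ)`.
  · refine ⟨commonInversions (w⁻¹ * σ) σ, ?_, ?_⟩
    · have h := two_mul_commonInversions w (w⁻¹ * σ)
      rw [mul_inv_cancel_left] at h
      omega
    · have h := restrict_ZSquare_diagonal σ (σ⁻¹ * w)
      rw [mul_inv_cancel_left, mul_inv_rev, inv_inv, diagonalProd_eq] at h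
      exact h.trans (mul_assoc _ _ _).symm
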